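/- Let $\mathcal X_1,\mathcal X_2,\mathcal X_3$ be finite sets and let $q=q_{X_1X_2X_3}$ be a probability distribution on $\mathcal X_1\times\mathcal X_2\times\mathcal X_3$. For rates $R_0,R_{12},R_{23}\ge 0$ and a block length $n$ let $\mathcal M_0,\mathcal M_{12},\mathcal M_{23}$ be the sets of integers from $1$ to $2^{nR_0}$, $2^{nR_{12}}$, $2^{nR_{23}}$, respectively. A $(2^{nR_0},2^{nR_{12}},2^{nR_{23}},n)$ line coordination code consists of maps $$f_{12}:\mathcal M_0\times\mathcal X_1^n\to\mathcal M_{12},\quad g_2:\mathcal M_0\times\mathcal M_{12}\to\mathcal X_2^n,\quad f_{23}:\mathcal M_0\times\mathcal M_{12}\to\mathcal M_{23},\quad g_3:\mathcal M_0\times\mathcal M_{23}\to\mathcal X_3^n.$$ It induces the joint distribution $p_{X_1^nX_2^nX_3^n}$ of the actions obtained when the common randomness $M_0$ is uniform on $\mathcal M_0$, $X_1^n$ is independent of $M_0$ and i.i.d. with law $q_{X_1}$, $M_{12}=f_{12}(M_0,X_1^n)$, $X_2^n=g_2(M_0,M_{12})$, $M_{23}=f_{23}(M_0,M_{12})$ and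 $X_3^n=g_3(M_0,M_{23})$. The triplet $(R_0,R_{12},R_{23})$ is achievable if there are such codes, one for each block length $n$, with $$\lim_{n\to\infty}\ \sum_{x_1^n,x_2^n,x_3^n}\Bigl|p_{X_1^nX_2^nX_3^n}(x_1^n,x_2^n,x_3^n)-\prod_{i=1}^n q(x_{1,i},x_{2,i},x_{3,i})\Bigr|=0 .$$ The coordination capacity region $\mathcal C(q)$ is the closure of the set of achievable triplets, and $$\mathcal C^*(q)=\{(R_{12},R_{23}) : (R_0,R_{12},R_{23})\in\mathcal C(q)\text{ for some }R_0\ge 0\}$$ is its projection onto the plane $R_0=0$ (common randomness of arbitrary rate is allowed). Then $$\mathcal C^*(q)=\{(R_{12},R_{23}) : R_{12}\ge I(X_2X_3;X_1),\ R_{23}\ge I(X_3;X_1)\},$$ where $I$ denotes mutual information in bits under $q$. The same equality holds if the agents may also use private randomness, that is, if $M_{12}$ is drawn from a conditional distribution given $(M_0,X_1^n)$, the pair $(X_2^n,M_{23})$ from one given $(M_0,M_{12})$, and $X_3^n$ from one given $(M_0,M_{23})$. -/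

import Mathlib

open Filter Topology
open scoped NNReal ENNReal

namespace LineCoordination

noncomputable section

/-- The mutual information `I(A;B)`, in bits, of a pair of finite random variables with
joint law `p`. Terms of probability zero contribute zero. -/
def mutualInfo {A B : Type*} [Fintype A] [Fintype B] (p : PMF (A × B)) : ℝ :=
  ∑ x : A × B, (p x).toReal *
    Real.logb 2 ((p x).toReal /
      (((p.map Prod.fst) x.1).toReal * ((p.map Prod.snd) x.2).toReal))

/-- The `L₁`-distance of two probability distributions on a finite set. -/
def l1Dist {A : Type*} [Fintype A] (p q : PMF A) : ℝ :=
  ∑ x, |(p x).toReal - (q x).toReal|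

/-- The law of `n` independent random variables with common law `q`:
`q^n(x) = ∏ i, q (x i)`. -/
def iid {A : Type*} [Fintype A] (q : PMF A) (n : ℕ) : PMF (Fin n → A) :=
  PMF.ofFintype (fun x => ∏ i, q (x i)) (by
    classical
    have hq : ∑ a, q a = 1 := by rw [← tsum_fintype (L := .unconditional A)]; exact q.tsum_coe
    have h := Finset.prod_univ_sum (fun _ : Fin n => (Finset.univ : Finset A)) (fun _ a => q a)
    rw [Fintype.piFinset_univ] at h
    rw [← h]
    simp [hq])

/-- The number of messages at rate `R` (in bits per action) and block length `n`, that is the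
number of integers in the interval from `1` to `2 ^ (n R)`. -/
def numMessages (n : ℕ) (R : ℝ≥0) : ℕ := ⌊(2 : ℝ) ^ ((n : ℝ) * (R : ℝ))⌋₊

instance numMessages_neZero (n : ℕ) (R : ℝ≥0) : NeZero (numMessages n R) :=
  ⟨(Nat.floor_pos.mpr (Real.one_le_rpow one_le_two (by positivity))).ne'⟩

section Codes

variable (X₁ X₂ X₃ : Type*)

/-- A line coordination code of block length `n` with `k₀` values of the common randomness,
`k₁₂` messages from Agent 1 to Agent 2 and `k₂₃` messages from Agent 2 to Agent 3. -/
structure LineCode (k₀ k₁₂ k₂₃ n : ℕ) where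
  /-- encoder of Agent 1 -/
  f₁₂ : Fin k₀ → (Fin n → X₁) → Fin k₁₂
  /-- actuator of Agent 2 -/
  g₂ : Fin k₀ → Fin k₁₂ → (Fin n → X₂)
  /-- encoder of Agent 2 -/
  f₂₃ : Fin k₀ → Fin k₁₂ → Fin k₂₃
  /-- actuator of Agent 3 -/
  g₃ : Fin k₀ → Fin k₂₃ → (Fin n → X₃)

/-- A line coordination code in which every agent may also use private randomness, independent
of everything else. The message and the actions that Agent 2 produces may depend on the same
private randomness, so that they are drawn jointly. -/
structure RandomizedLineCode (k₀ k₁₂ k₂₃ n : ℕ) where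
  /-- conditional law of the message of Agent 1 -/
  agent₁ : Fin k₀ → (Fin n → X₁) → PMF (Fin k₁₂)
  /-- conditional joint law of the actions and of the message of Agent 2 -/
  agent₂ : Fin k₀ → Fin k₁₂ → PMF ((Fin n → X₂) × Fin k₂₃)
  /-- conditional law of the actions of Agent 3 -/
  agent₃ : Fin k₀ → Fin k₂₃ → PMF (Fin n → X₃)

end Codes

section Region

variable {X₁ X₂ X₃ : Type*} [Fintype X₁] [Fintype X₂] [Fintype X₃]

/-- The joint law of the actions `(x₁ⁿ, x₂ⁿ, x₃ⁿ)` induced by a line coordination code: the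
common randomness is uniform and independent of the actions of Agent 1, and the latter are
i.i.d. with the first marginal of `q`. -/
def LineCode.induced {k₀ k₁₂ k₂₃ n : ℕ} [NeZero k₀] (c : LineCode X₁ X₂ X₃ k₀ k₁₂ k₂₃ n)
    (q : PMF (X₁ × X₂ × X₃)) : PMF (Fin n → X₁ × X₂ × X₃) :=
  (PMF.uniformOfFintype (Fin k₀)).bind fun m₀ =>
    (iid (q.map Prod.fst) n).map fun x₁ =>
      let m₁₂ := c.f₁₂ m₀ x₁
      let x₂ := c.g₂ m₀ m₁₂
      let m₂₃ := c.f₂₃ m₀ m₁₂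
      let x₃ := c.g₃ m₀ m₂₃
      fun i => (x₁ i, x₂ i, x₃ i)

/-- The joint law of the actions induced by a randomized line coordination code. -/
def RandomizedLineCode.induced {k₀ k₁₂ k₂₃ n : ℕ} [NeZero k₀]
    (c : RandomizedLineCode X₁ X₂ X₃ k₀ k₁₂ k₂₃ n)
    (q : PMF (X₁ × X₂ × X₃)) : PMF (Fin n → X₁ × X₂ × X₃) :=
  (PMF.uniformOfFintype (Fin k₀)).bind fun m₀ =>
    (iid (q.map Prod.fst) n).bind fun x₁ =>
      (c.agent₁ m₀ x₁).bind fun m₁₂ =>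
        (c.agent₂ m₀ m₁₂).bind fun y =>
          (c.agent₃ m₀ y.2).map fun x₃ =>
            fun i => (x₁ i, y.1 i, x₃ i)

/-- The rate triplet `(R₀, R₁₂, R₂₃)` is achievable for the target `q`. -/
def Achievable (q : PMF (X₁ × X₂ × X₃)) (R : ℝ≥0 × ℝ≥0 × ℝ≥0) : Prop :=
  ∃ c : ∀ n : ℕ, LineCode X₁ X₂ X₃
      (numMessages n R.1) (numMessages n R.2.1) (numMessages n R.2.2) n,
    Tendsto (fun n => l1Dist ((c n).induced q) (iid q n)) atTop (𝓝 0)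

/-- The rate triplet `(R₀, R₁₂, R₂₃)` is achievable for the target `q` by randomized codes. -/
def AchievableRandomized (q : PMF (X₁ × X₂ × X₃)) (R : ℝ≥0 × ℝ≥0 × ℝ≥0) : Prop :=
  ∃ c : ∀ n : ℕ, RandomizedLineCode X₁ X₂ X₃
      (numMessages n R.1) (numMessages n R.2.1) (numMessages n R.2.2) n,
    Tendsto (fun n => l1Dist ((c n).induced q) (iid q n)) atTop (𝓝 0)

/-- The coordination capacity region: the closure of the set of achievable triplets
`(R₀, R₁₂, R₂₃)`. -/
def capacityRegion (q : PMF (X₁ × X₂ × X₃)) : Set (ℝ≥0 × ℝ≥0 × ℝ≥0) :=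
  closure {R | Achievable q R}

/-- The coordination capacity region when the agents may use private randomness. -/
def capacityRegionRandomized (q : PMF (X₁ × X₂ × X₃)) : Set (ℝ≥0 × ℝ≥0 × ℝ≥0) :=
  closure {R | AchievableRandomized q R}

/-- The projection onto the plane `R₀ = 0` of a set of triplets `(R₀, R₁₂, R₂₃)`, as a set of
pairs `(R₁₂, R₂₃)`. -/
def projection (C : Set (ℝ≥0 × ℝ≥0 × ℝ≥0)) : Set (ℝ≥0 × ℝ≥0) :=
  {R | ∃ R₀ : ℝ≥0, (R₀, R.1, R.2) ∈ C}

end Region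

end

end LineCoordination

namespace LineCoordination

/-! The outer bound is proved for randomized codes and the inner bound for deterministic ones.
Deterministic codes are special randomized codes, so both equalities follow.

Converse. Given the common randomness and a message, the receiver's output is independent of `X₁ⁿ`.
Hence an event has at most the number of messages times the largest probability that it has with a
fixed output sequence and an independent `X₁ⁿ` (`toOuterMeasure_message_le`). For the jointly
typical set the latter is at most `2 ^ (-n (I - δ))` (`iid_snd_typical_le`), so a rate below `I`
would make typical sequences improbable, whereas the target law gives them probability tending to
one. This is applied to `M₁₂` with output `(X₂ⁿ, X₃ⁿ)` and to `M₂₃` with output `X₃ⁿ`.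

Achievability. Superposition coding: `J` cloud centers drawn from the law of `X₃ⁿ`, each with `L`
satellites drawn from the conditional law of `X₂ⁿ`. `M₁₂` names a center and one of its satellites,
`M₂₃` only the center. Agent 1 picks a word with probability proportional to its likelihood given
`x₁ⁿ`. Averaged over codebooks, the law of the chosen word is, by convexity of `1 / S` in the total
likelihood `S`, at least `1 - η` times the target at typical triples, where `η = 2 ^ (n (I(X₂X₃;X₁)
+ δ)) / (J L) + 2 ^ (n (I(X₃;X₁) + δ)) / J` (`le_sum_codebookWeight_mul_likelihoodEncoder`). A
one-sided bound suffices, since both laws have total mass one (`sum_abs_sub_le_of_dominates`).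

Since common randomness is plentiful, no single codebook has to be good: it selects both the
codebook and the outcome of the encoder's random choice for every `x₁ⁿ`. Finitely many samples
replace the average, with error `√((|X₂| |X₃|) ^ n / k₀)` (`exists_samples`), which vanishes at a
fixed large rate. -/

lemma sum_pi_prod {ι A K : Type*} [Fintype ι] [DecidableEq ι] [Fintype A] [CommSemiring K]
    (F : ι → A → K) :
    ∑ ω : ι → A, ∏ i, F i (ω i) = ∏ i, ∑ a, F i a := by
  classical
  have h := Finset.prod_univ_sum (fun _ : ι => (Finset.univ : Finset A)) F
  rw [Fintype.piFinset_univ] at h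
  exact h.symm

/-! ### Moments and Chebyshev's inequality under product weights. -/

section ProductWeights

variable {ι A : Type*} [Fintype ι] [DecidableEq ι] [Fintype A]

/-- The expectation of a function of one coordinate under a product weight. -/
lemma sum_pi_prod_mul_apply {ρ : ι → A → ℝ} (hρ : ∀ i, ∑ a, ρ i a = 1) (i : ι) (f : A → ℝ) :
    ∑ ω : ι → A, (∏ k, ρ k (ω k)) * f (ω i) = ∑ a, ρ i a * f a := by
  classical
  have h : ∀ ω : ι → A, (∏ k, ρ k (ω k)) * f (ω i) =
      ∏ k, (ρ k (ω k) * if k = i then f (ω k) else 1) := fun ω => by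
    rw [Finset.prod_mul_distrib]; simp
  simp_rw [h]
  rw [sum_pi_prod (fun k a => ρ k a * if k = i then f a else 1),
    Finset.prod_eq_single i (by intro k _ hk; simp [hk, hρ]) (by simp)]
  simp

/-- Functions of two different coordinates are independent under a product weight. -/
lemma sum_pi_prod_mul_apply_mul_apply {ρ : ι → A → ℝ} (hρ : ∀ i, ∑ a, ρ i a = 1) {i j : ι}
    (hij : i ≠ j) (f g : A → ℝ) :
    ∑ ω : ι → A, (∏ k, ρ k (ω k)) * (f (ω i) * g (ω j)) =
      (∑ a, ρ i a * f a) * ∑ a, ρ j a * g a := by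
  classical
  have h : ∀ ω : ι → A, (∏ k, ρ k (ω k)) * (f (ω i) * g (ω j)) =
      ∏ k, (ρ k (ω k) * ((if k = i then f (ω k) else 1) * if k = j then g (ω k) else 1)) :=
    fun ω => by rw [Finset.prod_mul_distrib, Finset.prod_mul_distrib]; simp
  simp_rw [h]
  rw [sum_pi_prod
    (fun k a => ρ k a * ((if k = i then f a else 1) * if k = j then g a else 1)),
    Finset.prod_eq_mul i j hij (by rintro k - ⟨hi, hj⟩; simp [hi, hj, hρ]) (by simp) (by simp)]
  simp [hij, hij.symm]

lemma sum_pi_prod_eq_one {ρ : ι → A → ℝ} (hρ : ∀ i, ∑ a, ρ i a = 1) :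
    ∑ ω : ι → A, ∏ k, ρ k (ω k) = 1 := by
  rw [sum_pi_prod, Finset.prod_congr rfl (fun i _ => hρ i), Finset.prod_const_one]

/-- The variance of a sum of independent, identically distributed, centred variables. -/
lemma sum_pi_prod_mul_sq_sum {ρ : A → ℝ} (hρ : ∑ a, ρ a = 1) {g : A → ℝ}
    (hg : ∑ a, ρ a * g a = 0) :
    ∑ ω : ι → A, (∏ k, ρ (ω k)) * (∑ i, g (ω i)) ^ 2 =
      Fintype.card ι * ∑ a, ρ a * g a ^ 2 := by
  classical
  have h : ∀ i j, ∑ ω : ι → A, (∏ k, ρ (ω k)) * (g (ω i) * g (ω j)) =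
      if i = j then ∑ a, ρ a * g a ^ 2 else 0 := by
    intro i j
    split_ifs with hij
    · subst hij
      simp_rw [← pow_two]
      exact sum_pi_prod_mul_apply (fun _ => hρ) i (fun a => g a ^ 2)
    · rw [sum_pi_prod_mul_apply_mul_apply (ρ := fun _ => ρ) (fun _ => hρ) hij, hg, zero_mul]
  simp_rw [pow_two, Finset.sum_mul_sum, Finset.mul_sum]
  rw [Finset.sum_comm]
  simp_rw [Finset.sum_comm (s := (Finset.univ : Finset (ι → A))), h]
  simp [pow_two, Finset.mul_sum]

/-- Chebyshev's inequality for a sum of independent, identically distributed, centred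
variables. -/
lemma sum_pi_prod_filter_le {ρ : A → ℝ} (hρ0 : ∀ a, 0 ≤ ρ a) (hρ : ∑ a, ρ a = 1) {g : A → ℝ}
    (hg : ∑ a, ρ a * g a = 0) {c : ℝ} (hc : 0 < c) (S : Set (ι → A)) [DecidablePred (· ∈ S)]
    (hS : ∀ ω ∈ S, c ≤ |∑ i, g (ω i)|) :
    ∑ ω : ι → A, (if ω ∈ S then ∏ k, ρ (ω k) else 0) ≤
      Fintype.card ι * (∑ a, ρ a * g a ^ 2) / c ^ 2 := by
  rw [le_div_iff₀ (by positivity), ← sum_pi_prod_mul_sq_sum hρ hg, Finset.sum_mul]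
  refine Finset.sum_le_sum fun ω _ => ?_
  have h0 : 0 ≤ ∏ k, ρ (ω k) := Finset.prod_nonneg fun k _ => hρ0 _
  split_ifs with h
  · refine mul_le_mul_of_nonneg_left ?_ h0
    rw [← sq_abs (∑ i, g (ω i))]
    exact pow_le_pow_left₀ hc.le (hS ω h) 2
  · rw [zero_mul]; positivity

end ProductWeights

/-- If one weight dominates a fixed fraction of another one outside a set of small weight, then
the two are close. -/
lemma sum_abs_sub_le_of_dominates {T : Type*} [Fintype T] {P Q : T → ℝ} (hP : ∀ t, 0 ≤ P t)
    (hQ : ∀ t, 0 ≤ Q t) (hP1 : ∑ t, P t = 1) (hQ1 : ∑ t, Q t = 1) (B : Set T)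
    [DecidablePred (· ∈ B)] {η ε : ℝ} (hη : 0 ≤ η) (hdom : ∀ t, t ∉ B → (1 - η) * P t ≤ Q t)
    (hB : ∑ t, (if t ∈ B then P t else 0) ≤ ε) :
    ∑ t, |Q t - P t| ≤ 2 * (η + ε) := by
  -- A real number's absolute value is the number plus twice its negative part. The negative part of
  -- `Q - P` is at most `η P` off `B` and at most `P` on `B`, and `Q - P` sums to zero.
  have h : ∀ t, |Q t - P t| ≤ Q t - P t + 2 * (η * P t + if t ∈ B then P t else 0) := by
    intro t
    have h1 := hP t
    have h2 := hQ t
    have h3 : 0 ≤ η * P t := by positivity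
    split_ifs with hb
    · rw [abs_le]; constructor <;> linarith
    · have := hdom t hb
      rw [abs_le]; constructor <;> linarith
  refine (Finset.sum_le_sum fun t _ => h t).trans ?_
  rw [Finset.sum_add_distrib, Finset.sum_sub_distrib, ← Finset.mul_sum, Finset.sum_add_distrib,
    ← Finset.mul_sum, hP1, hQ1]
  linarith

/-! ### Finite distributions: marginals, images and the L₁-distance. -/

section FinitePMF

variable {A B : Type*}

lemma toOuterMeasure_le_one (p : PMF A) (S : Set A) : p.toOuterMeasure S ≤ 1 := by
  calc p.toOuterMeasure S ≤ p.toOuterMeasure Set.univ :=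
        MeasureTheory.measure_mono (Set.subset_univ S)
    _ = 1 := (p.toOuterMeasure_apply_eq_one_iff _).mpr (Set.subset_univ _)

variable [Fintype A]

lemma sum_toReal_eq_one (p : PMF A) : ∑ a, (p a).toReal = 1 := by
  rw [← ENNReal.toReal_sum fun a _ => p.apply_ne_top a, ← tsum_fintype (L := .unconditional A),
    p.tsum_coe, ENNReal.toReal_one]

lemma map_apply_toReal [DecidableEq B] (p : PMF A) (φ : A → B) (b : B) :
    ((p.map φ) b).toReal = ∑ a, if φ a = b then (p a).toReal else 0 := by
  classical
  rw [PMF.map_apply, tsum_fintype, ENNReal.toReal_sum]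
  · refine Finset.sum_congr rfl fun a _ => ?_
    by_cases h : φ a = b
    · simp [h]
    · simp [h, Ne.symm h]
  · intro a _
    split_ifs
    · exact p.apply_ne_top a
    · simp

lemma sum_map_toReal_mul [Fintype B] (p : PMF A) (φ : A → B) (F : B → ℝ) :
    ∑ b, ((p.map φ) b).toReal * F b = ∑ a, (p a).toReal * F (φ a) := by
  classical
  simp_rw [map_apply_toReal, Finset.sum_mul]
  rw [Finset.sum_comm]
  simp [ite_mul]

lemma toOuterMeasure_toReal (p : PMF A) (S : Set A) [DecidablePred (· ∈ S)] :
    (p.toOuterMeasure S).toReal = ∑ a, if a ∈ S then (p a).toReal else 0 := by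
  rw [PMF.toOuterMeasure_apply, tsum_fintype, ENNReal.toReal_sum]
  · refine Finset.sum_congr rfl fun a _ => ?_
    by_cases h : a ∈ S <;> simp [h]
  · intro a _
    by_cases h : a ∈ S <;> simp [h, p.apply_ne_top a]

lemma toOuterMeasure_sub_le_l1Dist (p q : PMF A) (S : Set A) :
    (q.toOuterMeasure S).toReal - (p.toOuterMeasure S).toReal ≤ l1Dist p q := by
  classical
  rw [toOuterMeasure_toReal, toOuterMeasure_toReal, ← Finset.sum_sub_distrib]
  refine Finset.sum_le_sum fun a _ => ?_
  split_ifs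
  · rw [abs_sub_comm]; exact le_abs_self _
  · simp

lemma l1Dist_map_le [Fintype B] (p q : PMF A) (φ : A → B) :
    l1Dist (p.map φ) (q.map φ) ≤ l1Dist p q := by
  classical
  have h : ∀ b, |((p.map φ) b).toReal - ((q.map φ) b).toReal| ≤
      ∑ a, if φ a = b then |(p a).toReal - (q a).toReal| else 0 := by
    intro b
    rw [map_apply_toReal, map_apply_toReal, ← Finset.sum_sub_distrib]
    refine (Finset.abs_sum_le_sum_abs _ _).trans (Finset.sum_le_sum fun a _ => ?_)
    split_ifs <;> simp
  refine (Finset.sum_le_sum fun b _ => h b).trans ?_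
  rw [Finset.sum_comm]
  simp [l1Dist]

lemma map_fst_apply_toReal {C : Type*} [Fintype C] (p : PMF (A × C)) (a : A) :
    ((p.map Prod.fst) a).toReal = ∑ c, (p (a, c)).toReal := by
  classical
  rw [map_apply_toReal, Fintype.sum_prod_type, Finset.sum_comm]
  simp

lemma map_snd_apply_toReal {C : Type*} [Fintype C] (p : PMF (A × C)) (c : C) :
    ((p.map Prod.snd) c).toReal = ∑ a, (p (a, c)).toReal := by
  classical
  rw [map_apply_toReal, Fintype.sum_prod_type]
  simp

lemma toReal_le_map (p : PMF A) (φ : A → B) (a : A) :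
    (p a).toReal ≤ ((p.map φ) (φ a)).toReal := by
  classical
  rw [map_apply_toReal]
  refine le_trans ?_ (Finset.single_le_sum (f := fun x =>
    if φ x = φ a then (p x).toReal else 0) (fun x _ => ?_) (Finset.mem_univ a))
  · simp
  · split_ifs <;> simp

lemma iid_apply (q : PMF A) (n : ℕ) (x : Fin n → A) : iid q n x = ∏ i, q (x i) := by
  simp [iid]

lemma iid_apply_toReal (q : PMF A) (n : ℕ) (x : Fin n → A) :
    (iid q n x).toReal = ∏ i, (q (x i)).toReal := by
  rw [iid_apply, ENNReal.toReal_prod]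

lemma iid_map [Fintype B] (q : PMF A) (φ : A → B) (n : ℕ) :
    (iid q n).map (fun x i => φ (x i)) = iid (q.map φ) n := by
  classical
  ext y
  rw [iid_apply, PMF.map_apply, tsum_fintype]
  simp_rw [PMF.map_apply, tsum_fintype]
  rw [← sum_pi_prod (fun i a => if y i = φ a then q a else 0)]
  refine Finset.sum_congr rfl fun x _ => ?_
  rw [iid_apply]
  by_cases h : y = fun i => φ (x i)
  · rw [if_pos h]
    refine Finset.prod_congr rfl fun i _ => ?_
    rw [if_pos (congrFun h i)]
  · rw [if_neg h]
    obtain ⟨i, hi⟩ := Function.ne_iff.mp h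
    exact (Finset.prod_eq_zero (Finset.mem_univ i) (if_neg hi)).symm

end FinitePMF

/-! ### Information density, typical sequences and data processing. -/

section InformationDensity

variable {A B : Type*}

/-- The ratio of a joint law to the product of its marginals. -/
noncomputable def densityRatio (p : PMF (A × B)) (x : A × B) : ℝ :=
  (p x).toReal / (((p.map Prod.fst) x.1).toReal * ((p.map Prod.snd) x.2).toReal)

lemma densityRatio_nonneg (p : PMF (A × B)) (x : A × B) : 0 ≤ densityRatio p x := by
  unfold densityRatio; positivity

variable [Fintype A] [Fintype B]

lemma densityRatio_pos {p : PMF (A × B)} {x : A × B} (hx : 0 < (p x).toReal) :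
    0 < densityRatio p x :=
  div_pos hx (mul_pos (hx.trans_le (toReal_le_map p Prod.fst x))
    (hx.trans_le (toReal_le_map p Prod.snd x)))

/-- No positivity is needed: a point of positive mass has positive marginals, and at a point of mass
zero both sides vanish. -/
lemma marginals_mul_densityRatio (p : PMF (A × B)) (x : A × B) :
    ((p.map Prod.fst) x.1).toReal * ((p.map Prod.snd) x.2).toReal * densityRatio p x =
      (p x).toReal := by
  rcases (ENNReal.toReal_nonneg (a := p x)).eq_or_lt with h | h
  · simp [densityRatio, ← h]
  · have h1 := h.trans_le (toReal_le_map p Prod.fst x)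
    have h2 := h.trans_le (toReal_le_map p Prod.snd x)
    unfold densityRatio
    field_simp

lemma mutualInfo_eq (p : PMF (A × B)) :
    mutualInfo p = ∑ x, (p x).toReal * Real.logb 2 (densityRatio p x) := rfl

/-- The sequences whose normalized information density is not `δ`-close to the mutual
information. -/
def atypical (p : PMF (A × B)) (δ : ℝ) (n : ℕ) : Set (Fin n → A × B) :=
  {x | n * δ ≤ |∑ i, Real.logb 2 (densityRatio p (x i)) - n * mutualInfo p|}

/-- The weak law of large numbers for the information density. -/
lemma tendsto_iid_atypical (p : PMF (A × B)) {δ : ℝ} (hδ : 0 < δ) :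
    Tendsto (fun n => ((iid p n).toOuterMeasure (atypical p δ n)).toReal) atTop (𝓝 0) := by
  classical
  set g : A × B → ℝ := fun x => Real.logb 2 (densityRatio p x) - mutualInfo p
  set V : ℝ := ∑ a, (p a).toReal * g a ^ 2
  have hg : ∑ a, (p a).toReal * g a = 0 := by
    simp only [g, mul_sub, Finset.sum_sub_distrib, ← Finset.sum_mul, sum_toReal_eq_one,
      ← mutualInfo_eq, one_mul, sub_self]
  have hb : ∀ n : ℕ, 0 < n →
      ((iid p n).toOuterMeasure (atypical p δ n)).toReal ≤ V / δ ^ 2 * (1 / (n : ℝ)) := by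
    intro n hn
    have hn' : (0 : ℝ) < n := by exact_mod_cast hn
    rw [toOuterMeasure_toReal]
    simp_rw [iid_apply_toReal]
    refine (sum_pi_prod_filter_le (fun a => ENNReal.toReal_nonneg) (sum_toReal_eq_one p) hg
      (c := n * δ) (by positivity) (atypical p δ n) ?_).trans (le_of_eq ?_)
    · intro x hx
      have : ∑ i, g (x i) = ∑ i, Real.logb 2 (densityRatio p (x i)) - n * mutualInfo p := by
        simp [g, Finset.sum_sub_distrib]
      rw [this]
      exact hx
    · rw [Fintype.card_fin]
      field_simp
      rfl
  refine squeeze_zero' (Eventually.of_forall fun n => ENNReal.toReal_nonneg)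
    ((eventually_gt_atTop 0).mono hb) ?_
  simpa using tendsto_one_div_atTop_nhds_zero_nat.const_mul (V / δ ^ 2)

/-- Positivity of the sequence is essential: `Real.logb 2 0 = 0`, so a vanishing factor would leave
no trace in the exponent. -/
lemma prod_densityRatio_eq {p : PMF (A × B)} {n : ℕ} {x : Fin n → A × B}
    (hx : 0 < (iid p n x).toReal) :
    ∏ i, densityRatio p (x i) = (2 : ℝ) ^ ∑ i, Real.logb 2 (densityRatio p (x i)) := by
  rw [Real.rpow_sum_of_pos two_pos]
  refine Finset.prod_congr rfl fun i _ => (Real.rpow_logb two_pos (by norm_num) ?_).symm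
  refine densityRatio_pos (ENNReal.toReal_nonneg.lt_of_ne fun h => ?_)
  rw [iid_apply_toReal, Finset.prod_eq_zero (Finset.mem_univ i) h.symm] at hx
  exact hx.false

lemma prod_densityRatio_le {p : PMF (A × B)} {n : ℕ} {x : Fin n → A × B} {δ : ℝ}
    (hx : 0 < (iid p n x).toReal) (ht : x ∉ atypical p δ n) :
    ∏ i, densityRatio p (x i) ≤ (2 : ℝ) ^ (n * (mutualInfo p + δ)) := by
  rw [prod_densityRatio_eq hx]
  refine Real.rpow_le_rpow_of_exponent_le one_le_two ?_
  rw [atypical, Set.mem_ofPred_eq, not_le] at ht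
  have := (abs_lt.mp ht).2
  linarith

lemma le_prod_densityRatio {p : PMF (A × B)} {n : ℕ} {x : Fin n → A × B} {δ : ℝ}
    (hx : 0 < (iid p n x).toReal) (ht : x ∉ atypical p δ n) :
    (2 : ℝ) ^ (n * (mutualInfo p - δ)) ≤ ∏ i, densityRatio p (x i) := by
  rw [prod_densityRatio_eq hx]
  refine Real.rpow_le_rpow_of_exponent_le one_le_two ?_
  rw [atypical, Set.mem_ofPred_eq, not_le] at ht
  have := (abs_lt.mp ht).1
  linarith

/-- The data processing inequality for a function of the first variable. -/
lemma mutualInfo_map_le {C : Type*} [Fintype C] (p : PMF (A × B)) (φ : A → C) :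
    mutualInfo (p.map fun x => (φ x.1, x.2)) ≤ mutualInfo p := by
  set p' := p.map fun x => (φ x.1, x.2) with hp'
  have hsnd : p'.map Prod.snd = p.map Prod.snd := by
    rw [hp', PMF.map_comp]; rfl
  have hlog : 0 < Real.log 2 := Real.log_pos one_lt_two
  have hle : ∀ x : A × B, (p x).toReal ≤ (p' (φ x.1, x.2)).toReal :=
    toReal_le_map p fun x => (φ x.1, x.2)
  -- This is `log t ≤ t - 1` for the quotient `t` of the two ratios. The first term on the right
  -- sums to at most one, so the right-hand side sums to something nonpositive.
  have key : ∀ x : A × B, (p x).toReal * Real.logb 2 (densityRatio p' (φ x.1, x.2)) -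
      (p x).toReal * Real.logb 2 (densityRatio p x) ≤
      (((p.map Prod.fst) x.1).toReal / ((p'.map Prod.fst) (φ x.1)).toReal *
        (p' (φ x.1, x.2)).toReal - (p x).toReal) / Real.log 2 := by
    intro x
    rcases (ENNReal.toReal_nonneg (a := p x)).eq_or_lt with h | h
    · rw [← h]
      simp only [zero_mul, sub_zero]
      positivity
    · have h' := h.trans_le (hle x)
      have h1 := h.trans_le (toReal_le_map p Prod.fst x)
      have h2 := h.trans_le (toReal_le_map p Prod.snd x)
      have h3 := h'.trans_le (toReal_le_map p' Prod.fst (φ x.1, x.2))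
      have hr := densityRatio_pos h
      have hr' := densityRatio_pos h'
      rw [← mul_sub, ← Real.logb_div hr'.ne' hr.ne', Real.logb, ← mul_div_assoc]
      refine div_le_div_of_nonneg_right ?_ hlog.le
      refine (mul_le_mul_of_nonneg_left (Real.log_le_sub_one_of_pos (div_pos hr' hr)) h.le).trans
        (le_of_eq ?_)
      rw [mul_sub, mul_one]
      congr 1
      unfold densityRatio
      rw [hsnd]
      dsimp only at h3 ⊢
      field_simp
  have hsum : ∑ x : A × B, ((p.map Prod.fst) x.1).toReal / ((p'.map Prod.fst) (φ x.1)).toReal *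
        (p' (φ x.1, x.2)).toReal ≤ 1 := by
    classical
    rw [Fintype.sum_prod_type, ← sum_toReal_eq_one (p.map Prod.fst)]
    refine Finset.sum_le_sum fun a _ => ?_
    dsimp only
    rw [← Finset.mul_sum, ← map_fst_apply_toReal]
    rcases (ENNReal.toReal_nonneg (a := (p'.map Prod.fst) (φ a))).eq_or_lt with h0 | h0
    · rw [← h0, mul_zero]; exact ENNReal.toReal_nonneg
    · rw [div_mul_cancel₀ _ h0.ne']
  have h := Finset.sum_le_sum fun x (_ : x ∈ Finset.univ) => key x
  rw [Finset.sum_sub_distrib, ← Finset.sum_div, Finset.sum_sub_distrib, sum_toReal_eq_one,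
    ← mutualInfo_eq] at h
  have h0 := div_nonpos_of_nonpos_of_nonneg (sub_nonpos.mpr hsum) hlog.le
  rw [mutualInfo_eq p', hp', sum_map_toReal_mul p (fun x => (φ x.1, x.2)), ← hp']
  linarith

end InformationDensity

/-! ### Counting messages, and what a message can contribute to an event. -/

lemma numMessages_le (n : ℕ) (R : ℝ≥0) : (numMessages n R : ℝ) ≤ (2 : ℝ) ^ ((n : ℝ) * R) :=
  Nat.floor_le (by positivity)

lemma le_two_mul_numMessages (n : ℕ) (R : ℝ≥0) :
    (2 : ℝ) ^ ((n : ℝ) * R) ≤ 2 * numMessages n R := by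
  have h1 := Nat.lt_floor_add_one ((2 : ℝ) ^ ((n : ℝ) * R))
  have h2 : (1 : ℝ) ≤ numMessages n R := by exact_mod_cast NeZero.one_le
  unfold numMessages at *
  linarith

lemma tendsto_two_rpow_mul {c : ℝ} (hc : c < 0) :
    Tendsto (fun n : ℕ => (2 : ℝ) ^ ((n : ℝ) * c)) atTop (𝓝 0) := by
  have h : ∀ n : ℕ, (2 : ℝ) ^ ((n : ℝ) * c) = ((2 : ℝ) ^ c) ^ n := fun n => by
    rw [mul_comm, Real.rpow_mul_natCast two_pos.le]
  simp_rw [h]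
  exact tendsto_pow_atTop_nhds_zero_of_lt_one (by positivity)
    (Real.rpow_lt_one_of_one_lt_of_neg one_lt_two hc)

/-- If `a` is produced from shared randomness and a message with `|M|` values that may depend on
`x`, then an event has at most `|M|` times the probability that it could have for a fixed `a`. -/
lemma toOuterMeasure_message_le {Ω X M V T : Type*} [Fintype M] (U : PMF Ω) (μ : PMF X)
    (κ : Ω → X → PMF M) (ν : Ω → M → PMF V) (t : X → V → T) (S : Set T) {b : ℝ≥0∞}
    (hb : ∀ a, μ.toOuterMeasure {x | t x a ∈ S} ≤ b) :
    (U.bind fun m₀ => μ.bind fun x => (κ m₀ x).bind fun m =>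
      (ν m₀ m).map (t x)).toOuterMeasure S ≤ Fintype.card M * b := by
  -- With the message held fixed, `a` no longer depends on `x`, so the two may be drawn in the other
  -- order and `hb` applies to each `a`.
  have hfix : ∀ m₀ m, ∑' x, μ x * ((ν m₀ m).map (t x)).toOuterMeasure S ≤ b := by
    intro m₀ m
    have hcomm : (μ.bind fun x => (ν m₀ m).map (t x)) =
        (ν m₀ m).bind fun a => μ.map fun x => t x a :=
      PMF.bind_comm μ (ν m₀ m) fun x a => PMF.pure (t x a)
    rw [← PMF.toOuterMeasure_bind_apply, hcomm, PMF.toOuterMeasure_bind_apply]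
    simp_rw [PMF.toOuterMeasure_map_apply]
    refine (ENNReal.tsum_le_tsum fun a => mul_le_mul_right (hb a) _).trans ?_
    rw [ENNReal.tsum_mul_right, PMF.tsum_coe, one_mul]
  rw [PMF.toOuterMeasure_bind_apply]
  refine (ENNReal.tsum_le_tsum fun m₀ => mul_le_mul_right (?_ : _ ≤ Fintype.card M * b) _).trans ?_
  · simp_rw [PMF.toOuterMeasure_bind_apply]
    calc ∑' x, μ x * ∑' m, κ m₀ x m * ((ν m₀ m).map (t x)).toOuterMeasure S
        ≤ ∑' x, ∑ m, μ x * ((ν m₀ m).map (t x)).toOuterMeasure S := by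
          refine ENNReal.tsum_le_tsum fun x => ?_
          rw [tsum_fintype, Finset.mul_sum]
          refine Finset.sum_le_sum fun m _ => mul_le_mul_right ?_ _
          -- Discarding the probability of the message removes its dependence on `x`; the price is
          -- the factor `|M|`.
          exact mul_le_of_le_one_left' ((κ m₀ x).coe_le_one m)
      _ = ∑ m, ∑' x, μ x * ((ν m₀ m).map (t x)).toOuterMeasure S :=
          Summable.tsum_finsetSum fun _ _ => ENNReal.summable
      _ ≤ ∑ _m : M, b := Finset.sum_le_sum fun m _ => hfix m₀ m
      _ = Fintype.card M * b := by simp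
  · rw [ENNReal.tsum_mul_right, PMF.tsum_coe, one_mul]

/-! ### The converse. -/

section Converse

variable {A B : Type*} [Fintype A] [Fintype B]

/-- A fixed sequence is jointly typical with an independent one only with exponentially small
probability. -/
lemma iid_snd_typical_le (p : PMF (A × B)) (δ : ℝ) (n : ℕ) (a : Fin n → A) :
    (iid (p.map Prod.snd) n).toOuterMeasure
      {b | (fun i => (a i, b i)) ∈
        {x | 0 < (iid p n x).toReal ∧ x ∉ atypical p δ n}} ≤
      ENNReal.ofReal ((2 : ℝ) ^ (-(n * (mutualInfo p - δ)))) := by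
  classical
  refine ENNReal.le_ofReal_iff_toReal_le (ne_top_of_le_ne_top ENNReal.one_ne_top
    (toOuterMeasure_le_one _ _)) (by positivity) |>.mpr ?_
  rw [toOuterMeasure_toReal]
  set pa : ℝ := (iid (p.map Prod.fst) n a).toReal with hpa
  have hsum : ∑ b : Fin n → B, (iid p n fun i => (a i, b i)).toReal = pa := by
    simp_rw [hpa, iid_apply_toReal, map_fst_apply_toReal]
    exact sum_pi_prod fun i b => (p (a i, b)).toReal
  have hle : ∀ b : Fin n → B, (iid p n fun i => (a i, b i)).toReal ≤ pa := fun b => by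
    rw [← hsum]
    exact Finset.single_le_sum (f := fun b : Fin n → B => (iid p n fun i => (a i, b i)).toReal)
      (fun _ _ => ENNReal.toReal_nonneg) (Finset.mem_univ b)
  have hprod : ∀ b : Fin n → B, pa * (iid (p.map Prod.snd) n b).toReal *
      ∏ i, densityRatio p (a i, b i) = (iid p n fun i => (a i, b i)).toReal := fun b => by
    simp_rw [hpa, iid_apply_toReal, ← Finset.prod_mul_distrib]
    exact Finset.prod_congr rfl fun i _ => marginals_mul_densityRatio p (a i, b i)
  -- Change of measure: the marginal weight of `b` is its conditional weight given `a` divided by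
  -- the density ratio, which is large on typical pairs. The conditional weights sum to at most one.
  have hterm : ∀ b : Fin n → B, (if b ∈ {b | (fun i => (a i, b i)) ∈
      {x | 0 < (iid p n x).toReal ∧ x ∉ atypical p δ n}}
      then (iid (p.map Prod.snd) n b).toReal else 0) ≤
      (2 : ℝ) ^ (-(n * (mutualInfo p - δ))) * ((iid p n fun i => (a i, b i)).toReal / pa) := by
    intro b
    split_ifs with h
    · have hpos := h.1.trans_le (hle b)
      rw [← hprod, Real.rpow_neg two_pos.le]
      have h2 : (0 : ℝ) < (2 : ℝ) ^ (n * (mutualInfo p - δ)) := by positivity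
      have h3 := le_prod_densityRatio h.1 h.2
      rw [← div_eq_inv_mul, le_div_iff₀ h2, mul_assoc, mul_div_cancel_left₀ _ hpos.ne']
      exact mul_le_mul_of_nonneg_left h3 ENNReal.toReal_nonneg
    · positivity
  refine (Finset.sum_le_sum fun b _ => hterm b).trans ?_
  rw [← Finset.mul_sum, ← Finset.sum_div, hsum]
  exact mul_le_of_le_one_right (by positivity) (div_self_le_one _)

/-- A pair with `2 ^ (n R)` messages between its components can be close to the i.i.d. law of
`p` only if `R` is at least the mutual information. -/
lemma mutualInfo_le_of_tendsto (p : PMF (A × B)) (R : ℝ≥0) (r : ∀ n : ℕ, PMF (Fin n → A × B))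
    (hr : ∀ (n : ℕ) (S : Set (Fin n → A × B)) (b : ℝ≥0∞),
      (∀ a : Fin n → A, (iid (p.map Prod.snd) n).toOuterMeasure
        {y | (fun i => (a i, y i)) ∈ S} ≤ b) →
      (r n).toOuterMeasure S ≤ numMessages n R * b)
    (hlim : Tendsto (fun n => l1Dist (r n) (iid p n)) atTop (𝓝 0)) :
    mutualInfo p ≤ R := by
  classical
  by_contra! hlt
  -- Half the gap, so that `R - (mutualInfo p - δ) = -δ` and the typical set gets exponentially
  -- small weight under `r n`.
  set δ : ℝ := (mutualInfo p - R) / 2 with hδ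
  have hδ0 : 0 < δ := by rw [hδ]; linarith
  have hbound : ∀ n : ℕ, 1 ≤ (2 : ℝ) ^ ((n : ℝ) * -δ) + l1Dist (r n) (iid p n) +
      ((iid p n).toOuterMeasure (atypical p δ n)).toReal := by
    intro n
    set S : Set (Fin n → A × B) := {x | 0 < (iid p n x).toReal ∧ x ∉ atypical p δ n}
    have h1 : ((r n).toOuterMeasure S).toReal ≤ (2 : ℝ) ^ ((n : ℝ) * -δ) := by
      have h := ENNReal.toReal_mono (by finiteness) (hr n S _ (iid_snd_typical_le p δ n))
      rw [ENNReal.toReal_mul, ENNReal.toReal_natCast, ENNReal.toReal_ofReal (by positivity)] at h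
      refine h.trans ((mul_le_mul_of_nonneg_right (numMessages_le n R) (by positivity)).trans
        (le_of_eq ?_))
      rw [← Real.rpow_add two_pos, hδ]
      congr 1
      ring
    have h2 := toOuterMeasure_sub_le_l1Dist (r n) (iid p n) S
    have h3 : 1 ≤ ((iid p n).toOuterMeasure S).toReal +
        ((iid p n).toOuterMeasure (atypical p δ n)).toReal := by
      rw [toOuterMeasure_toReal, toOuterMeasure_toReal, ← Finset.sum_add_distrib,
        ← sum_toReal_eq_one (iid p n)]
      refine Finset.sum_le_sum fun x _ => ?_
      by_cases hx : x ∈ atypical p δ n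
      · rw [if_pos hx]
        split_ifs <;> simp
      · rw [if_neg hx, add_zero]
        split_ifs with hxS
        · exact le_rfl
        · exact not_lt.mp fun h => hxS ⟨h, hx⟩
    linarith
  have hto := ((tendsto_two_rpow_mul (neg_lt_zero.mpr hδ0)).add hlim).add
    (tendsto_iid_atypical p hδ0)
  have := ge_of_tendsto' hto hbound
  norm_num at this

lemma tendsto_l1Dist_map {q : PMF A} {r : ∀ n : ℕ, PMF (Fin n → A)} (φ : A → B)
    (h : Tendsto (fun n => l1Dist (r n) (iid q n)) atTop (𝓝 0)) :
    Tendsto (fun n => l1Dist ((r n).map fun x i => φ (x i)) (iid (q.map φ) n)) atTop (𝓝 0) := by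
  refine squeeze_zero (fun n => Finset.sum_nonneg fun _ _ => abs_nonneg _) (fun n => ?_) h
  rw [← iid_map]
  exact l1Dist_map_le _ _ _

variable {X₁ X₂ X₃ : Type*} [Fintype X₁] [Fintype X₂] [Fintype X₃]

/-- Two cuts of the line. Cutting at `M₁₂`, Agents 2 and 3 together form one receiver that produces
`(X₂ⁿ, X₃ⁿ)`. Cutting at `M₂₃`, Agents 1 and 2 together form one encoder and Agent 3 is the
receiver. -/
theorem AchievableRandomized.mutualInfo_le {q : PMF (X₁ × X₂ × X₃)} {R : ℝ≥0 × ℝ≥0 × ℝ≥0}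
    (h : AchievableRandomized q R) :
    mutualInfo (q.map fun x => ((x.2.1, x.2.2), x.1)) ≤ (R.2.1 : ℝ) ∧
      mutualInfo (q.map fun x => (x.2.2, x.1)) ≤ (R.2.2 : ℝ) := by
  obtain ⟨c, hc⟩ := h
  constructor
  · refine mutualInfo_le_of_tendsto _ R.2.1 _ (fun n S b hb => ?_) (tendsto_l1Dist_map _ hc)
    rw [PMF.map_comp] at hb
    have heq : (((c n).induced q).map fun x i => (((x i).2.1, (x i).2.2), (x i).1)) =
        (PMF.uniformOfFintype (Fin (numMessages n R.1))).bind fun m₀ =>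
          (iid (q.map Prod.fst) n).bind fun x₁ => ((c n).agent₁ m₀ x₁).bind fun m₁₂ =>
            (((c n).agent₂ m₀ m₁₂).bind fun y => ((c n).agent₃ m₀ y.2).map fun x₃ i =>
              (y.1 i, x₃ i)).map fun a i => (a i, x₁ i) := by
      simp only [RandomizedLineCode.induced, PMF.map_bind, PMF.map_comp]
      rfl
    rw [heq]
    simpa using toOuterMeasure_message_le _ (iid (q.map Prod.fst) n) (fun m₀ => (c n).agent₁ m₀)
      (fun m₀ m₁₂ => ((c n).agent₂ m₀ m₁₂).bind fun y => ((c n).agent₃ m₀ y.2).map fun x₃ i =>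
        (y.1 i, x₃ i)) (fun x₁ a i => (a i, x₁ i)) S hb
  · refine mutualInfo_le_of_tendsto _ R.2.2 _ (fun n S b hb => ?_) (tendsto_l1Dist_map _ hc)
    rw [PMF.map_comp] at hb
    have heq : (((c n).induced q).map fun x i => ((x i).2.2, (x i).1)) =
        (PMF.uniformOfFintype (Fin (numMessages n R.1))).bind fun m₀ =>
          (iid (q.map Prod.fst) n).bind fun x₁ => (((c n).agent₁ m₀ x₁).bind fun m₁₂ =>
            ((c n).agent₂ m₀ m₁₂).map Prod.snd).bind fun m₂₃ =>
              ((c n).agent₃ m₀ m₂₃).map fun a i => (a i, x₁ i) := by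
      simp only [RandomizedLineCode.induced, PMF.map_bind, PMF.map_comp, PMF.bind_bind,
        PMF.bind_map]
      rfl
    rw [heq]
    simpa using toOuterMeasure_message_le _ (iid (q.map Prod.fst) n) (fun m₀ x₁ =>
      ((c n).agent₁ m₀ x₁).bind fun m₁₂ => ((c n).agent₂ m₀ m₁₂).map Prod.snd)
      (fun m₀ m₂₃ => (c n).agent₃ m₀ m₂₃) (fun x₁ a i => (a i, x₁ i)) S hb

end Converse

/-! ### Random superposition codebooks and the likelihood encoder. -/

section SuperpositionCodebook

variable {ι κ Y Z : Type*} [Fintype ι] [Fintype κ]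

/-- The weight of a cloud center `z` and satellites `y l`, conditionally independent given `z`,
when `π` is the joint weight of a center and a satellite and `w` its marginal. -/
noncomputable def cloudWeight (w : Z → ℝ) (π : Z → Y → ℝ) (b : Z × (κ → Y)) : ℝ :=
  w b.1 * ∏ l, (π b.1 (b.2 l) / w b.1)

/-- The weight of a codebook of independent clouds. -/
noncomputable def codebookWeight (w : Z → ℝ) (π : Z → Y → ℝ) (C : ι → Z × (κ → Y)) : ℝ :=
  ∏ j, cloudWeight w π (C j)

lemma cloudWeight_nonneg {w : Z → ℝ} {π : Z → Y → ℝ} (hw : ∀ z, 0 ≤ w z)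
    (hπ : ∀ z y, 0 ≤ π z y) (b : Z × (κ → Y)) : 0 ≤ cloudWeight w π b :=
  mul_nonneg (hw _) (Finset.prod_nonneg fun _ _ => div_nonneg (hπ _ _) (hw _))

lemma codebookWeight_nonneg {w : Z → ℝ} {π : Z → Y → ℝ} (hw : ∀ z, 0 ≤ w z)
    (hπ : ∀ z y, 0 ≤ π z y) (C : ι → Z × (κ → Y)) : 0 ≤ codebookWeight w π C :=
  Finset.prod_nonneg fun _ _ => cloudWeight_nonneg hw hπ _

/-- The likelihood encoder chooses a word of the codebook with probability proportional to its
likelihood `r`. -/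
noncomputable def likelihoodEncoder (r : Z → Y → ℝ)
    (C : ι → Z × (κ → Y)) (k : ι × κ) : ℝ :=
  -- When no word has positive likelihood the choice is uniform, so that the encoder is always a
  -- probability distribution.
  if ∑ j, ∑ l, r (C j).1 ((C j).2 l) = 0 then 1 / (Fintype.card ι * Fintype.card κ)
  else r (C k.1).1 ((C k.1).2 k.2) / ∑ j, ∑ l, r (C j).1 ((C j).2 l)

lemma likelihoodEncoder_nonneg [Nonempty ι] [Nonempty κ] {r : Z → Y → ℝ} (hr : ∀ z y, 0 ≤ r z y)
    (C : ι → Z × (κ → Y)) (k : ι × κ) : 0 ≤ likelihoodEncoder r C k := by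
  unfold likelihoodEncoder
  split_ifs
  · positivity
  · exact div_nonneg (hr _ _) (Finset.sum_nonneg fun _ _ => Finset.sum_nonneg fun _ _ => hr _ _)

lemma sum_likelihoodEncoder [Nonempty ι] [Nonempty κ] (r : Z → Y → ℝ) (C : ι → Z × (κ → Y)) :
    ∑ k, likelihoodEncoder r C k = 1 := by
  unfold likelihoodEncoder
  split_ifs with h
  · simp
    field_simp
  · rw [← Finset.sum_div, Fintype.sum_prod_type, div_self h]

variable [Fintype Y] {w : Z → ℝ} {π : Z → Y → ℝ}

lemma sum_satellites_eq_one (hwπ : ∀ z, ∑ y, π z y = w z) {z : Z} (hz : w z ≠ 0) :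
    ∑ y, π z y / w z = 1 := by
  rw [← Finset.sum_div, hwπ, div_self hz]

variable [Fintype Z] [DecidableEq ι] [DecidableEq κ]

/-- The other satellites integrate out, which leaves the center and one satellite with joint weight
`π`. Centers of weight zero, where `π z y / w z` is a division by zero, carry no weight in either
sum. -/
lemma sum_cloudWeight_mul_apply (hπ : ∀ z y, 0 ≤ π z y) (hwπ : ∀ z, ∑ y, π z y = w z) (l : κ)
    (F : Z → Y → ℝ) :
    ∑ b : Z × (κ → Y), cloudWeight w π b * F b.1 (b.2 l) = ∑ z, ∑ y, π z y * F z y := by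
  rw [Fintype.sum_prod_type]
  refine Finset.sum_congr rfl fun z _ => ?_
  by_cases hz : w z = 0
  · have h0 : ∀ y, π z y = 0 := fun y =>
      (Finset.sum_eq_zero_iff_of_nonneg fun y _ => hπ z y).mp ((hwπ z).trans hz) y
        (Finset.mem_univ y)
    simp [cloudWeight, hz, h0]
  · simp_rw [cloudWeight, mul_assoc, ← Finset.mul_sum]
    rw [sum_pi_prod_mul_apply (ρ := fun _ y => π z y / w z)
      (fun _ => sum_satellites_eq_one hwπ hz) l (F z), Finset.mul_sum]
    refine Finset.sum_congr rfl fun y _ => ?_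
    field_simp

lemma sum_cloudWeight (hw : ∑ z, w z = 1) (hwπ : ∀ z, ∑ y, π z y = w z) :
    ∑ b : Z × (κ → Y), cloudWeight w π b = 1 := by
  rw [Fintype.sum_prod_type, ← hw]
  refine Finset.sum_congr rfl fun z _ => ?_
  by_cases hz : w z = 0
  · simp [cloudWeight, hz]
  · simp_rw [cloudWeight, ← Finset.mul_sum]
    rw [sum_pi_prod_eq_one (ρ := fun _ y => π z y / w z)
      (fun _ => sum_satellites_eq_one hwπ hz), mul_one]

lemma sum_codebookWeight (hw : ∑ z, w z = 1) (hwπ : ∀ z, ∑ y, π z y = w z) :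
    ∑ C : ι → Z × (κ → Y), codebookWeight w π C = 1 :=
  sum_pi_prod_eq_one (ρ := fun _ => cloudWeight w π) fun _ => sum_cloudWeight hw hwπ

variable [DecidableEq Y] [DecidableEq Z]

/-- The mean of the likelihood of a cloud in which a given word occurs at a given position. -/
lemma sum_cloudWeight_mul_ite_mul_le (hπ : ∀ z y, 0 ≤ π z y)
    (hwπ : ∀ z, ∑ y, π z y = w z) {r : Z → Y → ℝ} {s : Z → ℝ} (hs : ∀ z, 0 ≤ s z)
    (hrs : ∀ z, ∑ y, π z y * r z y = w z * s z) (l : κ) (z₀ : Z) (y₀ : Y) :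
    ∑ b : Z × (κ → Y), cloudWeight w π b *
      ((if (b.1, b.2 l) = (z₀, y₀) then 1 else 0) * ∑ l', r b.1 (b.2 l')) ≤
      π z₀ y₀ * (r z₀ y₀ + Fintype.card κ * s z₀) := by
  -- The prescribed satellite itself contributes `r z₀ y₀`. Every other satellite of the cloud is
  -- conditionally independent of it given the center `z₀`, and contributes the conditional mean `s
  -- z₀`.
  have hl : ∀ l', ∑ b : Z × (κ → Y), cloudWeight w π b *
      ((if (b.1, b.2 l) = (z₀, y₀) then 1 else 0) * r b.1 (b.2 l')) ≤
      (if l' = l then π z₀ y₀ * r z₀ y₀ else 0) + π z₀ y₀ * s z₀ := by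
    intro l'
    have hps := mul_nonneg (hπ z₀ y₀) (hs z₀)
    by_cases h : l' = l
    · subst h
      rw [sum_cloudWeight_mul_apply hπ hwπ l'
        (fun z y => (if (z, y) = (z₀, y₀) then 1 else 0) * r z y)]
      simp only [if_true, ← Fintype.sum_prod_type']
      rw [Finset.sum_eq_single (z₀, y₀) (by rintro ⟨z, y⟩ - hne; simp [hne]) (by simp)]
      simp [hps]
    · rw [if_neg h, zero_add, Fintype.sum_prod_type,
        Finset.sum_eq_single z₀ (by intro z _ hne; simp [hne]) (by simp)]
      by_cases hz : w z₀ = 0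
      · simp [cloudWeight, hz, hps]
      · simp_rw [cloudWeight, mul_assoc, ← Finset.mul_sum]
        rw [sum_pi_prod_mul_apply_mul_apply (ρ := fun _ y => π z₀ y / w z₀)
          (fun _ => sum_satellites_eq_one hwπ hz) (Ne.symm h)
          (fun y => if (z₀, y) = (z₀, y₀) then 1 else 0) (r z₀)]
        simp_rw [div_mul_eq_mul_div, ← Finset.sum_div, hrs]
        simp only [Prod.mk.injEq, true_and, mul_ite, mul_one, mul_zero, Finset.sum_ite_eq',
          Finset.mem_univ, if_true]
        field_simp
        exact le_rfl
  simp_rw [Finset.mul_sum]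
  rw [Finset.sum_comm]
  refine (Finset.sum_le_sum fun l' _ => hl l').trans (le_of_eq ?_)
  rw [Finset.sum_add_distrib]
  simp
  ring

/-- The mean of the likelihood of a codebook in which a given word occurs at a given position. -/
lemma sum_codebookWeight_mul_ite_mul_le (hπ : ∀ z y, 0 ≤ π z y)
    (hw : ∑ z, w z = 1) (hwπ : ∀ z, ∑ y, π z y = w z)
    {r : Z → Y → ℝ} {s : Z → ℝ} (hs : ∀ z, 0 ≤ s z)
    (hrs : ∀ z, ∑ y, π z y * r z y = w z * s z) (hs1 : ∑ z, w z * s z ≤ 1)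
    (j : ι) (l : κ) (z₀ : Z) (y₀ : Y) :
    ∑ C : ι → Z × (κ → Y), codebookWeight w π C *
      ((if ((C j).1, (C j).2 l) = (z₀, y₀) then 1 else 0) *
        ∑ j', ∑ l', r (C j').1 ((C j').2 l')) ≤
      π z₀ y₀ * (r z₀ y₀ + Fintype.card κ * s z₀ + Fintype.card ι * Fintype.card κ) := by
  set I : Z × (κ → Y) → ℝ := fun b => if (b.1, b.2 l) = (z₀, y₀) then 1 else 0 with hI
  set h : Z × (κ → Y) → ℝ := fun b => ∑ l', r b.1 (b.2 l') with hh
  have hβ : ∑ b : Z × (κ → Y), cloudWeight w π b = 1 := sum_cloudWeight hw hwπ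
  have hEI : ∑ b, cloudWeight w π b * I b = π z₀ y₀ := by
    rw [hI, sum_cloudWeight_mul_apply hπ hwπ l
      (fun z y => if (z, y) = (z₀, y₀) then 1 else 0), ← Fintype.sum_prod_type',
      Finset.sum_eq_single (z₀, y₀) (by rintro ⟨z, y⟩ - hne; simp [hne]) (by simp)]
    simp
  have hEh : ∑ b, cloudWeight w π b * h b ≤ Fintype.card κ := by
    simp_rw [hh, Finset.mul_sum]
    rw [Finset.sum_comm]
    simp_rw [sum_cloudWeight_mul_apply hπ hwπ, hrs]
    rw [Finset.sum_const, Finset.card_univ, nsmul_eq_mul]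
    exact mul_le_of_le_one_right (by positivity) hs1
  -- Clouds other than the prescribed one are independent of it, and each adds a mean likelihood of
  -- at most `|κ|`.
  have hj : ∀ j', ∑ C : ι → Z × (κ → Y), codebookWeight w π C * (I (C j) * h (C j')) ≤
      (if j' = j then π z₀ y₀ * (r z₀ y₀ + Fintype.card κ * s z₀) else 0) +
        π z₀ y₀ * Fintype.card κ := by
    intro j'
    by_cases hjj : j' = j
    · subst hjj
      rw [if_pos rfl]
      refine le_add_of_le_of_nonneg ?_ (mul_nonneg (hπ _ _) (by positivity))
      unfold codebookWeight
      rw [sum_pi_prod_mul_apply (ρ := fun _ => cloudWeight w π) (fun _ => hβ) j'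
        (fun b => I b * h b)]
      exact sum_cloudWeight_mul_ite_mul_le hπ hwπ hs hrs l z₀ y₀
    · unfold codebookWeight
      rw [if_neg hjj, zero_add, sum_pi_prod_mul_apply_mul_apply (ρ := fun _ => cloudWeight w π)
        (fun _ => hβ) (Ne.symm hjj) I h, hEI]
      exact mul_le_mul_of_nonneg_left hEh (hπ _ _)
  have hexp : ∀ C : ι → Z × (κ → Y), codebookWeight w π C * (I (C j) * ∑ j', h (C j')) =
      ∑ j', codebookWeight w π C * (I (C j) * h (C j')) := fun C => by
    simp_rw [Finset.mul_sum]
  change ∑ C : ι → Z × (κ → Y), codebookWeight w π C * (I (C j) * ∑ j', h (C j')) ≤ _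
  simp_rw [hexp]
  rw [Finset.sum_comm]
  refine (Finset.sum_le_sum fun j' _ => hj j').trans (le_of_eq ?_)
  rw [Finset.sum_add_distrib]
  simp
  ring

lemma sum_codebookWeight_mul_ite (hπ : ∀ z y, 0 ≤ π z y)
    (hw : ∑ z, w z = 1) (hwπ : ∀ z, ∑ y, π z y = w z) (j : ι) (l : κ) (z₀ : Z) (y₀ : Y) :
    ∑ C : ι → Z × (κ → Y), codebookWeight w π C *
      (if ((C j).1, (C j).2 l) = (z₀, y₀) then 1 else 0) = π z₀ y₀ := by
  unfold codebookWeight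
  rw [sum_pi_prod_mul_apply (ρ := fun _ => cloudWeight w π) (fun _ => sum_cloudWeight hw hwπ) j
    (fun b => if (b.1, b.2 l) = (z₀, y₀) then 1 else 0),
    sum_cloudWeight_mul_apply hπ hwπ l
      (fun z y => if (z, y) = (z₀, y₀) then 1 else 0), ← Fintype.sum_prod_type',
    Finset.sum_eq_single (z₀, y₀) (by rintro ⟨z, y⟩ - hne; simp [hne]) (by simp)]
  simp

variable [Nonempty ι] [Nonempty κ]

/-- A one-shot lower bound for the law of the word that the likelihood encoder chooses. -/
lemma le_sum_codebookWeight_mul_likelihoodEncoder (hw0 : ∀ z, 0 ≤ w z) (hπ : ∀ z y, 0 ≤ π z y)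
    (hw : ∑ z, w z = 1) (hwπ : ∀ z, ∑ y, π z y = w z)
    {r : Z → Y → ℝ} {s : Z → ℝ} (hr : ∀ z y, 0 ≤ r z y) (hs : ∀ z, 0 ≤ s z)
    (hrs : ∀ z, ∑ y, π z y * r z y = w z * s z) (hs1 : ∑ z, w z * s z ≤ 1)
    (z₀ : Z) (y₀ : Y) :
    Fintype.card ι * Fintype.card κ * (π z₀ y₀ * r z₀ y₀ /
      (r z₀ y₀ + Fintype.card κ * s z₀ + Fintype.card ι * Fintype.card κ)) ≤
    ∑ C : ι → Z × (κ → Y), codebookWeight w π C * ∑ k, likelihoodEncoder r C k *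
      (if ((C k.1).1, (C k.1).2 k.2) = (z₀, y₀) then 1 else 0) := by
  -- `D` bounds the conditional mean of the total likelihood, given that the word sits at a
  -- prescribed position. Its three terms come from the word itself, the rest of its cloud and the
  -- other clouds.
  set D : ℝ := r z₀ y₀ + Fintype.card κ * s z₀ + Fintype.card ι * Fintype.card κ with hD
  have hD0 : 0 < D := by
    have := hr z₀ y₀
    have := hs z₀
    positivity
  rcases (hr z₀ y₀).eq_or_lt with h0 | h0
  · rw [← h0]
    simp only [mul_zero, zero_div]
    refine Finset.sum_nonneg fun C _ => mul_nonneg (codebookWeight_nonneg hw0 hπ C)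
      (Finset.sum_nonneg fun k _ => mul_nonneg (likelihoodEncoder_nonneg hr C k) ?_)
    split_ifs <;> simp
  set S : (ι → Z × (κ → Y)) → ℝ := fun C => ∑ j, ∑ l, r (C j).1 ((C j).2 l)
  set I : ι × κ → (ι → Z × (κ → Y)) → ℝ :=
    fun k C => if ((C k.1).1, (C k.1).2 k.2) = (z₀, y₀) then 1 else 0 with hI
  -- the tangent to `1 / S` at `S = D`
  have htan : ∀ k C, r z₀ y₀ * (2 / D * I k C - I k C * S C / D ^ 2) ≤
      likelihoodEncoder r C k * I k C := by
    intro k C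
    simp only [hI]
    split_ifs with h
    · rw [Prod.mk.injEq] at h
      have hle : r z₀ y₀ ≤ S C := by
        rw [← h.1, ← h.2]
        exact (Finset.single_le_sum (f := fun l => r (C k.1).1 ((C k.1).2 l))
          (fun l _ => hr _ _) (Finset.mem_univ k.2)).trans
          (Finset.single_le_sum (f := fun j => ∑ l, r (C j).1 ((C j).2 l))
          (fun j _ => Finset.sum_nonneg fun l _ => hr _ _) (Finset.mem_univ k.1))
      have hS0 : 0 < S C := h0.trans_le hle
      have henc : likelihoodEncoder r C k = r z₀ y₀ / S C := by
        rw [likelihoodEncoder, if_neg hS0.ne', h.1, h.2]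
      rw [henc, mul_one, mul_one, one_mul, div_eq_mul_one_div (r z₀ y₀)]
      refine mul_le_mul_of_nonneg_left ?_ h0.le
      rw [← sub_nonneg]
      have : 1 / S C - (2 / D - S C / D ^ 2) = (D - S C) ^ 2 / (D ^ 2 * S C) := by
        field_simp
        ring
      rw [this]
      positivity
    · simp
  have hk : ∀ k : ι × κ, π z₀ y₀ * r z₀ y₀ / D ≤
      ∑ C : ι → Z × (κ → Y), codebookWeight w π C * (likelihoodEncoder r C k * I k C) := by
    intro k
    have h1 := sum_codebookWeight_mul_ite hπ hw hwπ k.1 k.2 z₀ y₀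
    have h2 := sum_codebookWeight_mul_ite_mul_le hπ hw hwπ hs hrs hs1 k.1 k.2 z₀ y₀
    rw [← hD] at h2
    calc π z₀ y₀ * r z₀ y₀ / D
        = r z₀ y₀ * (2 / D * π z₀ y₀ - π z₀ y₀ * D / D ^ 2) := by field_simp; ring
      _ ≤ r z₀ y₀ * (2 / D * (∑ C, codebookWeight w π C * I k C) -
            (∑ C, codebookWeight w π C * (I k C * S C)) / D ^ 2) := by
          refine mul_le_mul_of_nonneg_left ?_ h0.le
          rw [h1]
          exact sub_le_sub_left (div_le_div_of_nonneg_right h2 (by positivity)) _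
      _ = ∑ C, codebookWeight w π C *
            (r z₀ y₀ * (2 / D * I k C - I k C * S C / D ^ 2)) := by
          rw [Finset.mul_sum, Finset.sum_div, ← Finset.sum_sub_distrib, Finset.mul_sum]
          exact Finset.sum_congr rfl fun C _ => by ring
      _ ≤ _ := Finset.sum_le_sum fun C _ =>
          mul_le_mul_of_nonneg_left (htan k C) (codebookWeight_nonneg hw0 hπ C)
  simp_rw [Finset.mul_sum]
  rw [Finset.sum_comm]
  refine le_trans (le_of_eq ?_) (Finset.sum_le_sum fun k _ => hk k)
  simp

end SuperpositionCodebook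

/-! ### Replacing averages by common randomness: one-shot coordination. -/

/-- Averaging `k` independent samples of a random function `d` approximates its law at every
point. -/
lemma exists_samples {Ω X V : Type*} [Fintype Ω] [Fintype X] [Fintype V] [DecidableEq V]
    {ρ : Ω → ℝ} (hρ0 : ∀ ω, 0 ≤ ρ ω) (hρ : ∑ ω, ρ ω = 1) {μ : X → ℝ} (hμ0 : ∀ x, 0 ≤ μ x)
    (hμ : ∑ x, μ x = 1) (d : Ω → X → V) {k : ℕ} (hk : 0 < k) :
    ∃ ω : Fin k → Ω, ∑ x, μ x * ∑ v, |(1 / (k : ℝ)) * (∑ m, if d (ω m) x = v then 1 else 0) -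
      ∑ ω', ρ ω' * (if d ω' x = v then 1 else 0)| ≤ √(Fintype.card V / k) := by
  set Q : X → V → ℝ := fun x v => ∑ ω', ρ ω' * (if d ω' x = v then 1 else 0) with hQ
  set g : X → V → Ω → ℝ := fun x v ω => (if d ω x = v then 1 else 0) - Q x v with hg
  have hk' : (0 : ℝ) < k := by exact_mod_cast hk
  have hQ1 : ∀ x, ∑ v, Q x v = 1 := fun x => by
    simp only [hQ]
    rw [Finset.sum_comm]
    simp [hρ]
  have hvar : ∀ x v, ∑ ω : Fin k → Ω, (∏ m, ρ (ω m)) * (∑ m, g x v (ω m)) ^ 2 ≤ k * Q x v := by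
    intro x v
    have hg0 : ∑ ω, ρ ω * g x v ω = 0 := by
      simp only [hg, mul_sub, Finset.sum_sub_distrib, ← Finset.sum_mul, hρ]
      simp [hQ]
    rw [sum_pi_prod_mul_sq_sum hρ hg0, Fintype.card_fin]
    refine mul_le_mul_of_nonneg_left ?_ hk'.le
    -- An indicator equals its square, so the variance is `Q - Q ^ 2 ≤ Q`. Keeping `Q` rather than a
    -- constant makes the sum over `v` equal to one.
    have : ∀ ω, ρ ω * g x v ω ^ 2 =
        ρ ω * (if d ω x = v then 1 else 0) - 2 * Q x v * (ρ ω * (if d ω x = v then 1 else 0)) +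
          ρ ω * Q x v ^ 2 := by
      intro ω
      simp only [hg]
      split_ifs <;> ring
    simp_rw [this]
    rw [Finset.sum_add_distrib, Finset.sum_sub_distrib, ← Finset.mul_sum, ← Finset.sum_mul, hρ]
    change Q x v - 2 * Q x v * Q x v + 1 * Q x v ^ 2 ≤ Q x v
    nlinarith [sq_nonneg (Q x v)]
  set N : (Fin k → Ω) → X → ℝ := fun ω x => ∑ v, |∑ m, g x v (ω m)| with hN
  have hmean : ∑ ω : Fin k → Ω, (∏ m, ρ (ω m)) * ∑ x, μ x * N ω x ^ 2 ≤
      Fintype.card V * k := by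
    have hx : ∀ x, ∑ ω : Fin k → Ω, (∏ m, ρ (ω m)) * N ω x ^ 2 ≤ Fintype.card V * k := by
      intro x
      calc ∑ ω : Fin k → Ω, (∏ m, ρ (ω m)) * N ω x ^ 2
          ≤ ∑ ω : Fin k → Ω, (∏ m, ρ (ω m)) *
              (Fintype.card V * ∑ v, (∑ m, g x v (ω m)) ^ 2) := by
            refine Finset.sum_le_sum fun ω _ => mul_le_mul_of_nonneg_left ?_
              (Finset.prod_nonneg fun _ _ => hρ0 _)
            refine (sq_sum_le_card_mul_sum_sq (s := Finset.univ)
              (f := fun v => |∑ m, g x v (ω m)|)).trans (le_of_eq ?_)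
            simp [sq_abs]
        _ = Fintype.card V * ∑ v, ∑ ω : Fin k → Ω, (∏ m, ρ (ω m)) *
              (∑ m, g x v (ω m)) ^ 2 := by
            rw [Finset.sum_comm, Finset.mul_sum]
            refine Finset.sum_congr rfl fun ω _ => ?_
            rw [← Finset.mul_sum]
            ring
        _ ≤ Fintype.card V * ∑ v, (k : ℝ) * Q x v := by
            gcongr with v
            exact hvar x v
        _ = Fintype.card V * k := by rw [← Finset.mul_sum, hQ1, mul_one]
    calc ∑ ω : Fin k → Ω, (∏ m, ρ (ω m)) * ∑ x, μ x * N ω x ^ 2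
        = ∑ x, μ x * ∑ ω : Fin k → Ω, (∏ m, ρ (ω m)) * N ω x ^ 2 := by
          simp_rw [Finset.mul_sum]
          rw [Finset.sum_comm]
          exact Finset.sum_congr rfl fun x _ => Finset.sum_congr rfl fun ω _ => by ring
      _ ≤ ∑ x, μ x * (Fintype.card V * k) := by
          gcongr with x
          · exact hμ0 x
          · exact hx x
      _ = Fintype.card V * k := by rw [← Finset.sum_mul, hμ, one_mul]
  -- Some sample does no worse than the mean.
  obtain ⟨ω, hω⟩ : ∃ ω : Fin k → Ω, ∑ x, μ x * N ω x ^ 2 ≤ Fintype.card V * k := by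
    by_contra! hcon
    have h1 : ∑ ω : Fin k → Ω, ∏ m, ρ (ω m) = 1 := sum_pi_prod_eq_one fun _ => hρ
    have hlt : ∑ ω : Fin k → Ω, (∏ m, ρ (ω m)) * (Fintype.card V * k : ℝ) <
        ∑ ω : Fin k → Ω, (∏ m, ρ (ω m)) * ∑ x, μ x * N ω x ^ 2 := by
      obtain ⟨ω, -, hω⟩ := Finset.exists_ne_zero_of_sum_ne_zero (h1.trans_ne one_ne_zero)
      have hnn : ∀ ω : Fin k → Ω, 0 ≤ ∏ m, ρ (ω m) := fun ω =>
        Finset.prod_nonneg fun _ _ => hρ0 _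
      exact Finset.sum_lt_sum (fun ω _ => mul_le_mul_of_nonneg_left (hcon ω).le (hnn ω))
        ⟨ω, Finset.mem_univ ω, mul_lt_mul_of_pos_left (hcon ω) ((hnn ω).lt_of_ne' hω)⟩
    rw [← Finset.sum_mul, h1, one_mul] at hlt
    exact hlt.not_ge hmean
  refine ⟨ω, ?_⟩
  have hdiff : ∀ x v, |(1 / (k : ℝ)) * (∑ m, if d (ω m) x = v then 1 else 0) - Q x v| =
      1 / k * |∑ m, g x v (ω m)| := by
    intro x v
    rw [← abs_of_pos (one_div_pos.mpr hk'), ← abs_mul, abs_of_pos (one_div_pos.mpr hk')]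
    congr 1
    simp only [hg, Finset.sum_sub_distrib, Finset.sum_const, Finset.card_univ, Fintype.card_fin,
      nsmul_eq_mul]
    field_simp
  refine (Finset.sum_congr rfl fun x _ => congrArg (μ x * ·)
    (Finset.sum_congr rfl fun v _ => hdiff x v)).trans_le ?_
  simp_rw [← Finset.mul_sum]
  refine Real.le_sqrt_of_sq_le ((Real.pow_arith_mean_le_arith_mean_pow Finset.univ μ _
    (fun x _ => hμ0 x) hμ (fun x _ => by positivity) 2).trans ?_)
  have : ∀ x, μ x * (1 / (k : ℝ) * ∑ v, |∑ m, g x v (ω m)|) ^ 2 =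
      1 / (k : ℝ) ^ 2 * (μ x * N ω x ^ 2) := fun x => by simp only [hN]; ring
  rw [Finset.sum_congr rfl fun x _ => this x, ← Finset.mul_sum, one_div_mul_eq_div,
    div_le_div_iff₀ (by positivity) hk']
  nlinarith

/-- A one-shot coordination code: `k` samples of a superposition codebook, together with a
deterministic choice of the codeword, approximate a joint weight `μ x * π z y * r x z y`. -/
lemma exists_superposition_code {ι κ X Y Z : Type*} [Fintype ι] [Fintype κ] [Fintype X]
    [Fintype Y] [Fintype Z] [Nonempty ι] [Nonempty κ] [DecidableEq Y] [DecidableEq Z]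
    {μ : X → ℝ} {w : Z → ℝ} {π : Z → Y → ℝ} {r : X → Z → Y → ℝ} {s : X → Z → ℝ}
    (hμ0 : ∀ x, 0 ≤ μ x) (hμ : ∑ x, μ x = 1) (hw0 : ∀ z, 0 ≤ w z) (hw : ∑ z, w z = 1)
    (hπ : ∀ z y, 0 ≤ π z y) (hwπ : ∀ z, ∑ y, π z y = w z)
    (hr : ∀ x z y, 0 ≤ r x z y) (hs : ∀ x z, 0 ≤ s x z)
    (hrs : ∀ x z, ∑ y, π z y * r x z y = w z * s x z) (hs1 : ∀ x, ∑ z, w z * s x z ≤ 1)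
    (hP : ∑ t : X × Z × Y, μ t.1 * (π t.2.1 t.2.2 * r t.1 t.2.1 t.2.2) = 1)
    (B : Set (X × Z × Y)) [DecidablePred (· ∈ B)] {a b ε : ℝ} (ha : 0 ≤ a) (hb : 0 ≤ b)
    (hB : ∑ t : X × Z × Y,
      (if t ∈ B then μ t.1 * (π t.2.1 t.2.2 * r t.1 t.2.1 t.2.2) else 0) ≤ ε)
    (hra : ∀ x z y, (x, z, y) ∉ B → 0 < μ x * (π z y * r x z y) → r x z y ≤ a)
    (hsb : ∀ x z y, (x, z, y) ∉ B → 0 < μ x * (π z y * r x z y) → s x z ≤ b)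
    {k : ℕ} (hk : 0 < k) :
    ∃ (C : Fin k → ι → Z × (κ → Y)) (f : Fin k → X → ι × κ),
      ∑ t : X × Z × Y, |μ t.1 * ((1 / (k : ℝ)) *
          ∑ m, (if ((C m (f m t.1).1).1, (C m (f m t.1).1).2 (f m t.1).2) = t.2 then 1 else 0)) -
        μ t.1 * (π t.2.1 t.2.2 * r t.1 t.2.1 t.2.2)| ≤
      2 * ((a / (Fintype.card ι * Fintype.card κ) + b / Fintype.card ι) + ε) +
        √(Fintype.card (Z × Y) / k) := by
  classical
  set word : (ι → Z × (κ → Y)) → ι × κ → Z × Y := fun C k => ((C k.1).1, (C k.1).2 k.2)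
  -- The encoder's randomness moves into the common randomness: the whole selection function is
  -- drawn in advance, independently for each `x`. Only its value at the actual `x` matters, and
  -- this has the law of the likelihood encoder.
  set ρ : (ι → Z × (κ → Y)) × (X → ι × κ) → ℝ := fun ω =>
    codebookWeight w π ω.1 * ∏ x, likelihoodEncoder (r x) ω.1 (ω.2 x) with hρdef
  have hρ0 : ∀ ω, 0 ≤ ρ ω := fun ω => mul_nonneg (codebookWeight_nonneg hw0 hπ _)
    (Finset.prod_nonneg fun x _ => likelihoodEncoder_nonneg (hr x) _ _)
  have hsel : ∀ C : ι → Z × (κ → Y), ∀ x, ∑ k, likelihoodEncoder (r x) C k = 1 :=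
    fun C x => sum_likelihoodEncoder (r x) C
  have hρ : ∑ ω, ρ ω = 1 := by
    rw [Fintype.sum_prod_type]
    simp_rw [hρdef, ← Finset.mul_sum]
    rw [← sum_codebookWeight (ι := ι) (κ := κ) hw hwπ]
    refine Finset.sum_congr rfl fun C _ => ?_
    rw [sum_pi_prod_eq_one (ρ := fun x => likelihoodEncoder (r x) C) (hsel C), mul_one]
  set Q : X → Z × Y → ℝ := fun x v =>
    ∑ ω, ρ ω * (if word ω.1 (ω.2 x) = v then 1 else 0) with hQdef
  have hQ0 : ∀ x v, 0 ≤ Q x v := fun x v => Finset.sum_nonneg fun ω _ =>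
    mul_nonneg (hρ0 ω) (by split_ifs <;> simp)
  have hQ : ∀ x v, Q x v = ∑ C : ι → Z × (κ → Y), codebookWeight w π C *
      ∑ k, likelihoodEncoder (r x) C k * (if word C k = v then 1 else 0) := by
    intro x v
    simp only [hQdef]
    rw [Fintype.sum_prod_type]
    refine Finset.sum_congr rfl fun C _ => ?_
    simp_rw [hρdef, mul_assoc, ← Finset.mul_sum]
    rw [sum_pi_prod_mul_apply (ρ := fun x => likelihoodEncoder (r x) C) (hsel C) x
      (fun k => if word C k = v then 1 else 0)]
  have hQ1 : ∀ x, ∑ v, Q x v = 1 := fun x => by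
    simp only [hQdef]
    rw [Finset.sum_comm]
    exact Eq.trans (by simp) hρ
  obtain ⟨ω, hω⟩ := exists_samples hρ0 hρ hμ0 hμ (fun ω x => word ω.1 (ω.2 x)) hk
  refine ⟨fun m => (ω m).1, fun m => (ω m).2, ?_⟩
  set N : ℝ := Fintype.card ι * Fintype.card κ with hN
  have hι : (0 : ℝ) < Fintype.card ι := by exact_mod_cast Fintype.card_pos
  have hκ : (0 : ℝ) < Fintype.card κ := by exact_mod_cast Fintype.card_pos
  have hN0 : 0 < N := by positivity
  have hdom : ∀ t : X × Z × Y, t ∉ B →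
      (1 - (a / N + b / Fintype.card ι)) * (μ t.1 * (π t.2.1 t.2.2 * r t.1 t.2.1 t.2.2)) ≤
      μ t.1 * Q t.1 t.2 := by
    rintro ⟨x, z, y⟩ ht
    dsimp only
    have hP0 : 0 ≤ μ x * (π z y * r x z y) :=
      mul_nonneg (hμ0 x) (mul_nonneg (hπ z y) (hr x z y))
    rcases hP0.eq_or_lt with h0 | h0
    · rw [← h0, mul_zero]
      exact mul_nonneg (hμ0 x) (hQ0 _ _)
    · have h1 := hra x z y ht h0
      have h2 := hsb x z y ht h0
      have hq := le_sum_codebookWeight_mul_likelihoodEncoder (ι := ι) (κ := κ) hw0 hπ hw hwπ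
        (hr x) (hs x) (hrs x) (hs1 x) z y
      rw [← hN] at hq
      rw [mul_left_comm]
      refine mul_le_mul_of_nonneg_left ?_ (hμ0 x)
      rw [hQ]
      refine le_trans ?_ hq
      have hD : 0 < r x z y + Fintype.card κ * s x z + N := by
        have := hr x z y
        have := hs x z
        positivity
      have hD' : 0 < a + Fintype.card κ * b + N := by positivity
      have hmono : r x z y + Fintype.card κ * s x z + N ≤ a + Fintype.card κ * b + N := by
        gcongr
      rw [mul_div_assoc', mul_comm N, mul_div_assoc, mul_comm]
      refine mul_le_mul_of_nonneg_left ?_ (mul_nonneg (hπ z y) (hr x z y))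
      -- This is `1 - t ≤ 1 / (1 + t)` with `t = (a + |κ| b) / N`.
      calc 1 - (a / N + b / Fintype.card ι) = 1 - (a + Fintype.card κ * b) / N := by
            rw [hN]; field_simp
        _ ≤ N / (a + Fintype.card κ * b + N) := by
            rw [one_sub_div hN0.ne', div_le_div_iff₀ hN0 hD']
            nlinarith [sq_nonneg (a + Fintype.card κ * b)]
        _ ≤ _ := div_le_div_of_nonneg_left hN0.le hD hmono
  have hfst := sum_abs_sub_le_of_dominates
    (P := fun t : X × Z × Y => μ t.1 * (π t.2.1 t.2.2 * r t.1 t.2.1 t.2.2))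
    (Q := fun t : X × Z × Y => μ t.1 * Q t.1 t.2)
    (fun t => mul_nonneg (hμ0 _) (mul_nonneg (hπ _ _) (hr _ _ _)))
    (fun t => mul_nonneg (hμ0 _) (hQ0 _ _)) hP
    (by rw [Fintype.sum_prod_type]; simp_rw [← Finset.mul_sum, hQ1, mul_one]; exact hμ)
    B (η := a / N + b / Fintype.card ι) (by positivity) hdom hB
  have hsnd : ∑ t : X × Z × Y, |μ t.1 * ((1 / (k : ℝ)) *
        ∑ m, (if word (ω m).1 ((ω m).2 t.1) = t.2 then 1 else 0)) - μ t.1 * Q t.1 t.2| ≤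
      √(Fintype.card (Z × Y) / k) := by
    refine le_trans (le_of_eq ?_) hω
    rw [Fintype.sum_prod_type]
    refine Finset.sum_congr rfl fun x _ => ?_
    rw [Finset.mul_sum]
    refine Finset.sum_congr rfl fun v _ => ?_
    rw [← mul_sub, abs_mul, abs_of_nonneg (hμ0 x)]
  refine le_trans ?_ (le_trans (add_le_add hsnd hfst) (le_of_eq (add_comm _ _)))
  rw [← Finset.sum_add_distrib]
  exact Finset.sum_le_sum fun t _ => abs_sub_le _ _ _

/-! ### Averages of the density ratio. -/

lemma densityRatio_eq_zero {A B : Type*} {p : PMF (A × B)} {x : A × B}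
    (h : ((p.map Prod.snd) x.2).toReal = 0) : densityRatio p x = 0 := by
  rw [densityRatio, h, mul_zero, div_zero]

/-- For `b` of positive probability the terms are the conditional probabilities of `a` given `b`,
with sum one. For `b` of probability zero every ratio is a division by zero, hence zero; therefore
only an inequality. -/
lemma sum_fst_mul_densityRatio {A B : Type*} [Fintype A] [Fintype B] (p : PMF (A × B)) (b : B) :
    ∑ a, ((p.map Prod.fst) a).toReal * densityRatio p (a, b) ≤ 1 := by
  rcases (ENNReal.toReal_nonneg (a := (p.map Prod.snd) b)).eq_or_lt with h | h
  · simp [fun a => densityRatio_eq_zero (p := p) (x := (a, b)) h.symm, -PMF.map_apply]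
  · refine le_of_eq (mul_left_cancel₀ h.ne' ?_)
    rw [mul_one, Finset.mul_sum]
    refine Eq.trans (Finset.sum_congr rfl fun a _ => ?_) (map_snd_apply_toReal p b).symm
    rw [← marginals_mul_densityRatio p (a, b)]
    ring

/-- Averaging the likelihood of a word over its satellite leaves the likelihood of its center. This
gives `s` from `r` in the superposition code. -/
lemma sum_fst_mul_densityRatio_prod {A C B : Type*} [Fintype A] [Fintype C] [Fintype B]
    (p : PMF ((A × C) × B)) (c : C) (b : B) :
    ∑ a, ((p.map Prod.fst) (a, c)).toReal * densityRatio p ((a, c), b) =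
      ((p.map fun x => x.1.2) c).toReal * densityRatio (p.map fun x => (x.1.2, x.2)) (c, b) := by
  have hsnd : (p.map fun x => (x.1.2, x.2)).map Prod.snd = p.map Prod.snd := by
    rw [PMF.map_comp]; rfl
  have hfst : (p.map fun x => (x.1.2, x.2)).map Prod.fst = p.map fun x => x.1.2 := by
    rw [PMF.map_comp]; rfl
  rcases (ENNReal.toReal_nonneg (a := (p.map Prod.snd) b)).eq_or_lt with h | h
  · rw [densityRatio_eq_zero (x := (c, b)) (by rw [hsnd, ← h]), mul_zero]
    refine Finset.sum_eq_zero fun a _ => ?_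
    rw [densityRatio_eq_zero (x := ((a, c), b)) h.symm, mul_zero]
  · refine mul_left_cancel₀ h.ne' ?_
    have h1 := marginals_mul_densityRatio (p.map fun x => (x.1.2, x.2)) (c, b)
    rw [hsnd, hfst] at h1
    dsimp only at h1
    rw [mul_comm ((p.map fun x => x.1.2) c).toReal, mul_assoc] at h1
    rw [h1, Finset.mul_sum]
    have h2 : ((p.map fun x => (x.1.2, x.2)) (c, b)).toReal = ∑ a, (p ((a, c), b)).toReal := by
      classical
      rw [map_apply_toReal, Fintype.sum_prod_type, Fintype.sum_prod_type]
      refine Finset.sum_congr rfl fun a _ => ?_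
      rw [Finset.sum_eq_single c (fun c' _ hc => by simp [hc]) (by simp)]
      simp
    rw [h2]
    refine Finset.sum_congr rfl fun a _ => ?_
    rw [← marginals_mul_densityRatio p ((a, c), b)]
    ring

/-! ### Line codes from superposition codebooks. -/

section Codes

variable {X₁ X₂ X₃ : Type*}

/-- `M₁₂` carries the cloud index and the satellite index, and Agent 2 forwards the cloud index
alone. That suffices for Agent 3, whose actions are the cloud center. -/
lemma exists_lineCode_of_superposition {k₀ k₁₂ k₂₃ n J L : ℕ} [NeZero J] [NeZero L]
    (hJL : J * L ≤ k₁₂) (hJ : J ≤ k₂₃)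
    (C : Fin k₀ → Fin J → (Fin n → X₃) × (Fin L → Fin n → X₂))
    (f : Fin k₀ → (Fin n → X₁) → Fin J × Fin L) :
    ∃ c : LineCode X₁ X₂ X₃ k₀ k₁₂ k₂₃ n, ∀ m x,
      c.g₃ m (c.f₂₃ m (c.f₁₂ m x)) = (C m (f m x).1).1 ∧
      c.g₂ m (c.f₁₂ m x) = (C m (f m x).1).2 (f m x).2 := by
  obtain ⟨e⟩ := Function.Embedding.nonempty_of_card_le (α := Fin J × Fin L) (β := Fin k₁₂)
    (by simpa using hJL)
  -- Decoding by `Function.invFun` is arbitrary on messages outside the range, but these are never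
  -- sent.
  have he := Function.leftInverse_invFun e.injective
  have he' := Function.leftInverse_invFun (Fin.castLE_injective hJ)
  refine ⟨⟨fun m x => e (f m x),
    fun m j => (C m (Function.invFun e j).1).2 (Function.invFun e j).2,
    fun _ j => Fin.castLE hJ (Function.invFun e j).1,
    fun m j => (C m (Function.invFun (Fin.castLE hJ) j)).1⟩, fun m x => ?_⟩
  simp only [he (f m x), he' (f m x).1, and_self]

variable [Fintype X₁]

lemma LineCode.induced_apply_toReal {k₀ k₁₂ k₂₃ n : ℕ} [NeZero k₀]
    [DecidableEq X₂] [DecidableEq X₃]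
    (c : LineCode X₁ X₂ X₃ k₀ k₁₂ k₂₃ n) (q : PMF (X₁ × X₂ × X₃))
    (x : Fin n → X₁) (z : Fin n → X₃) (y : Fin n → X₂) :
    (c.induced q fun i => (x i, y i, z i)).toReal = (iid (q.map Prod.fst) n x).toReal *
      ((1 / (k₀ : ℝ)) * ∑ m, if (c.g₃ m (c.f₂₃ m (c.f₁₂ m x)), c.g₂ m (c.f₁₂ m x)) = (z, y)
        then 1 else 0) := by
  classical
  rw [LineCode.induced, PMF.bind_apply, tsum_fintype, ENNReal.toReal_sum
    (fun m _ => ENNReal.mul_ne_top (PMF.apply_ne_top _ _) (PMF.apply_ne_top _ _)),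
    Finset.mul_sum, Finset.mul_sum]
  refine Finset.sum_congr rfl fun m _ => ?_
  rw [ENNReal.toReal_mul, map_apply_toReal, Finset.sum_eq_single x ?_ (by simp)]
  · have hiff : ((fun i => (x i, c.g₂ m (c.f₁₂ m x) i, c.g₃ m (c.f₂₃ m (c.f₁₂ m x)) i)) =
        fun i => (x i, y i, z i)) ↔
        (c.g₃ m (c.f₂₃ m (c.f₁₂ m x)), c.g₂ m (c.f₁₂ m x)) = (z, y) := by
      simp only [funext_iff, Prod.mk.injEq, true_and]
      exact ⟨fun h => ⟨fun i => (h i).2, fun i => (h i).1⟩, fun h i => ⟨h.2 i, h.1 i⟩⟩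
    simp only [hiff, PMF.uniformOfFintype_apply, Fintype.card_fin, ENNReal.toReal_inv,
      ENNReal.toReal_natCast]
    split_ifs <;> ring
  · intro x' _ hne
    rw [if_neg]
    intro h
    exact hne (funext fun i => congrArg Prod.fst (congrFun h i))

/-- Triples of sequences as sequences of triples. -/
def tripleEquiv (X₁ X₂ X₃ : Type*) (n : ℕ) :
    ((Fin n → X₁) × (Fin n → X₃) × (Fin n → X₂)) ≃ (Fin n → X₁ × X₂ × X₃) where
  toFun t i := (t.1 i, t.2.2 i, t.2.1 i)
  invFun x := (fun i => (x i).1, fun i => (x i).2.2, fun i => (x i).2.1)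
  left_inv _ := rfl
  right_inv _ := rfl

variable [Fintype X₂] [Fintype X₃]

/-- The one-shot code is applied to `n`-fold products, with centers `x₃ⁿ` and satellites `x₂ⁿ`. The
exceptional set consists of triples atypical for `(X₂X₃, X₁)` or for `(X₃, X₁)`; off it, positive
triples have likelihood ratios of at most `2 ^ (n (I + δ))`. -/
lemma exists_lineCode_l1Dist_le (q : PMF (X₁ × X₂ × X₃)) {k₀ k₁₂ k₂₃ n J L : ℕ}
    [NeZero k₀] [NeZero J] [NeZero L] (hJL : J * L ≤ k₁₂) (hJ : J ≤ k₂₃) (δ : ℝ) :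
    ∃ c : LineCode X₁ X₂ X₃ k₀ k₁₂ k₂₃ n, l1Dist (c.induced q) (iid q n) ≤
      2 * (((2 : ℝ) ^ (n * (mutualInfo (q.map fun x => ((x.2.1, x.2.2), x.1)) + δ)) / (J * L) +
        (2 : ℝ) ^ (n * (mutualInfo (q.map fun x => (x.2.2, x.1)) + δ)) / J) +
        (((iid (q.map fun x => ((x.2.1, x.2.2), x.1)) n).toOuterMeasure
          (atypical (q.map fun x => ((x.2.1, x.2.2), x.1)) δ n)).toReal +
        ((iid (q.map fun x => (x.2.2, x.1)) n).toOuterMeasure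
          (atypical (q.map fun x => (x.2.2, x.1)) δ n)).toReal)) +
      √(((Fintype.card X₂ * Fintype.card X₃ : ℕ) : ℝ) ^ n / k₀) := by
  classical
  set φ : X₁ × X₂ × X₃ → (X₂ × X₃) × X₁ := fun x => ((x.2.1, x.2.2), x.1) with hφ
  set ψ : X₁ × X₂ × X₃ → X₃ × X₁ := fun x => (x.2.2, x.1)
  set p := q.map φ with hp
  set p' := q.map ψ with hp'
  have hp'p : p' = p.map fun x => (x.1.2, x.2) := by rw [hp, PMF.map_comp]; rfl
  have hq₁ : q.map Prod.fst = p.map Prod.snd := by rw [hp, PMF.map_comp]; rfl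
  have hq₃ : p'.map Prod.fst = p.map fun x => x.1.2 := by rw [hp'p, PMF.map_comp]; rfl
  have hq₃' : p'.map Prod.fst = (p.map Prod.fst).map Prod.snd := by
    rw [hq₃]; exact (PMF.map_comp Prod.fst p Prod.snd).symm
  set μ : (Fin n → X₁) → ℝ := fun x => ∏ i, ((q.map Prod.fst) (x i)).toReal with hμ
  set w : (Fin n → X₃) → ℝ := fun z => ∏ i, ((p'.map Prod.fst) (z i)).toReal with hw
  set π : (Fin n → X₃) → (Fin n → X₂) → ℝ :=
    fun z y => ∏ i, ((p.map Prod.fst) (y i, z i)).toReal with hπ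
  set r : (Fin n → X₁) → (Fin n → X₃) → (Fin n → X₂) → ℝ :=
    fun x z y => ∏ i, densityRatio p ((y i, z i), x i) with hr
  set s : (Fin n → X₁) → (Fin n → X₃) → ℝ :=
    fun x z => ∏ i, densityRatio p' (z i, x i) with hs
  have hpq : ∀ x y z, (p ((y, z), x)).toReal = (q (x, y, z)).toReal := by
    intro x y z
    rw [hp, map_apply_toReal, Finset.sum_eq_single (x, y, z) _ (by simp)]
    · simp [hφ]
    · rintro ⟨x', y', z'⟩ - hne
      rw [if_neg]
      intro h
      simp only [hφ, Prod.mk.injEq] at h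
      exact hne (by rw [h.1.1, h.1.2, h.2])
  have hP : ∀ x z y, μ x * (π z y * r x z y) = (iid q n fun i => (x i, y i, z i)).toReal := by
    intro x z y
    simp only [hμ, hπ, hr]
    rw [iid_apply_toReal, ← Finset.prod_mul_distrib, ← Finset.prod_mul_distrib]
    refine Finset.prod_congr rfl fun i _ => ?_
    rw [← hpq, ← marginals_mul_densityRatio p, hq₁]
    ring
  have hPt : ∀ t : (Fin n → X₁) × (Fin n → X₃) × (Fin n → X₂),
      μ t.1 * (π t.2.1 t.2.2 * r t.1 t.2.1 t.2.2) =
        (iid q n (tripleEquiv X₁ X₂ X₃ n t)).toReal := fun t => hP t.1 t.2.1 t.2.2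
  have hpos : ∀ (x : Fin n → X₁) (z : Fin n → X₃) (y : Fin n → X₂),
      0 < μ x * (π z y * r x z y) →
      0 < (iid p n fun i => ((y i, z i), x i)).toReal ∧
      0 < (iid p' n fun i => (z i, x i)).toReal := by
    intro x z y h
    rw [hP] at h
    constructor
    · rw [hp, ← iid_map]
      exact h.trans_le (toReal_le_map (iid q n) (fun t i => φ (t i)) fun i => (x i, y i, z i))
    · rw [hp', ← iid_map]
      exact h.trans_le (toReal_le_map (iid q n) (fun t i => ψ (t i)) fun i => (x i, y i, z i))
  set S : Set (Fin n → X₁ × X₂ × X₃) := (fun t i => φ (t i)) ⁻¹' atypical p δ n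
  set S' : Set (Fin n → X₁ × X₂ × X₃) := (fun t i => ψ (t i)) ⁻¹' atypical p' δ n
  have hmeas : ((iid q n).toOuterMeasure (S ∪ S')).toReal ≤
      ((iid p n).toOuterMeasure (atypical p δ n)).toReal +
        ((iid p' n).toOuterMeasure (atypical p' δ n)).toReal := by
    have hne : ∀ T : Set (Fin n → X₁ × X₂ × X₃), (iid q n).toOuterMeasure T ≠ ⊤ := fun T =>
      ne_top_of_le_ne_top ENNReal.one_ne_top (toOuterMeasure_le_one _ _)
    rw [hp, hp', ← iid_map, ← iid_map, PMF.toOuterMeasure_map_apply,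
      PMF.toOuterMeasure_map_apply, ← hp, ← hp', ← ENNReal.toReal_add (hne _) (hne _)]
    exact ENNReal.toReal_mono (ENNReal.add_ne_top.mpr ⟨hne _, hne _⟩)
      (MeasureTheory.measure_union_le _ _)
  obtain ⟨C, f, hCf⟩ := exists_superposition_code (ι := Fin J) (κ := Fin L) (μ := μ) (w := w)
    (π := π) (r := r) (s := s)
    (fun x => Finset.prod_nonneg fun _ _ => ENNReal.toReal_nonneg)
    (sum_pi_prod_eq_one fun _ => sum_toReal_eq_one _)
    (fun z => Finset.prod_nonneg fun _ _ => ENNReal.toReal_nonneg)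
    (sum_pi_prod_eq_one fun _ => sum_toReal_eq_one _)
    (fun z y => Finset.prod_nonneg fun _ _ => ENNReal.toReal_nonneg)
    (fun z => by
      simp only [hπ, hw]
      rw [sum_pi_prod (fun i y => ((p.map Prod.fst) (y, z i)).toReal)]
      refine Finset.prod_congr rfl fun i _ => ?_
      rw [hq₃', map_snd_apply_toReal])
    (fun x z y => Finset.prod_nonneg fun _ _ => densityRatio_nonneg _ _)
    (fun x z => Finset.prod_nonneg fun _ _ => densityRatio_nonneg _ _)
    (fun x z => by
      simp only [hπ, hw, hr, hs, ← Finset.prod_mul_distrib]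
      rw [sum_pi_prod (fun i y => ((p.map Prod.fst) (y, z i)).toReal *
        densityRatio p ((y, z i), x i))]
      refine Finset.prod_congr rfl fun i _ => ?_
      rw [sum_fst_mul_densityRatio_prod, hq₃, hp'p])
    (fun x => by
      simp only [hw, hs, ← Finset.prod_mul_distrib]
      rw [sum_pi_prod (fun i z => ((p'.map Prod.fst) z).toReal * densityRatio p' (z, x i))]
      refine Finset.prod_le_one (fun i _ => Finset.sum_nonneg fun z _ =>
        mul_nonneg ENNReal.toReal_nonneg (densityRatio_nonneg _ _)) fun i _ => ?_
      exact sum_fst_mul_densityRatio p' (x i))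
    (by
      simp_rw [hPt]
      rw [(tripleEquiv X₁ X₂ X₃ n).sum_comp fun t => (iid q n t).toReal]
      exact sum_toReal_eq_one _)
    (tripleEquiv X₁ X₂ X₃ n ⁻¹' (S ∪ S'))
    (a := (2 : ℝ) ^ (n * (mutualInfo p + δ))) (b := (2 : ℝ) ^ (n * (mutualInfo p' + δ)))
    (ε := ((iid p n).toOuterMeasure (atypical p δ n)).toReal +
      ((iid p' n).toOuterMeasure (atypical p' δ n)).toReal)
    (by positivity) (by positivity)
    (by
      simp_rw [hPt, Set.mem_preimage]
      rw [(tripleEquiv X₁ X₂ X₃ n).sum_comp fun t =>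
        if t ∈ S ∪ S' then (iid q n t).toReal else 0, ← toOuterMeasure_toReal]
      exact hmeas)
    (fun x z y ht h => prod_densityRatio_le (hpos x z y h).1 fun h' => ht (Or.inl h'))
    (fun x z y ht h => prod_densityRatio_le (hpos x z y h).2 fun h' => ht (Or.inr h'))
    (NeZero.pos k₀)
  obtain ⟨c, hc⟩ := exists_lineCode_of_superposition hJL hJ C f
  refine ⟨c, ?_⟩
  rw [l1Dist, ← (tripleEquiv X₁ X₂ X₃ n).sum_comp]
  convert hCf using 1
  · refine Finset.sum_congr rfl fun t _ => ?_
    rw [hPt]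
    congr 2
    change (c.induced q fun i => (t.1 i, t.2.2 i, t.2.1 i)).toReal = _
    rw [LineCode.induced_apply_toReal, iid_apply_toReal]
    simp only [hc]
    rfl
  · simp [mul_pow, mul_comm]

end Codes

/-! ### Choice of rates, and passage to the closure. -/

section Achievability

lemma div_numMessages_le (n : ℕ) (R : ℝ≥0) (c : ℝ) :
    (2 : ℝ) ^ ((n : ℝ) * c) / numMessages n R ≤ 2 * (2 : ℝ) ^ ((n : ℝ) * (c - R)) := by
  have h0 : (0 : ℝ) < numMessages n R := by exact_mod_cast NeZero.pos _
  rw [div_le_iff₀ h0, mul_sub, Real.rpow_sub two_pos]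
  have h1 := le_two_mul_numMessages n R
  have h2 : (0 : ℝ) < (2 : ℝ) ^ ((n : ℝ) * R) := by positivity
  calc (2 : ℝ) ^ ((n : ℝ) * c)
      = (2 : ℝ) ^ ((n : ℝ) * c) / (2 : ℝ) ^ ((n : ℝ) * R) * (2 : ℝ) ^ ((n : ℝ) * R) := by
        field_simp
    _ ≤ (2 : ℝ) ^ ((n : ℝ) * c) / (2 : ℝ) ^ ((n : ℝ) * R) * (2 * numMessages n R) := by gcongr
    _ = _ := by ring

lemma tendsto_div_numMessages {R : ℝ≥0} {c : ℝ} (h : c < R) :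
    Tendsto (fun n : ℕ => (2 : ℝ) ^ ((n : ℝ) * c) / numMessages n R) atTop (𝓝 0) := by
  refine squeeze_zero (fun n => by positivity) (fun n => div_numMessages_le n R c) ?_
  simpa using (tendsto_two_rpow_mul (sub_neg.mpr h)).const_mul 2

/-- Since `N < 2 ^ N`, rate `N` outgrows the `N ^ n` pairs of output sequences. The rate is
wasteful, but `R₀` is unrestricted and this one is a natural number. -/
lemma tendsto_pow_div_numMessages (N : ℕ) :
    Tendsto (fun n : ℕ => (N : ℝ) ^ n / numMessages n (N : ℝ≥0)) atTop (𝓝 0) := by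
  have hlt : (N : ℝ) / 2 ^ N < 1 := by
    rw [div_lt_one (by positivity)]
    exact_mod_cast Nat.lt_two_pow_self
  have hle : ∀ n : ℕ, (N : ℝ) ^ n / numMessages n (N : ℝ≥0) ≤ 2 * ((N : ℝ) / 2 ^ N) ^ n := by
    intro n
    have h0 : (0 : ℝ) < numMessages n (N : ℝ≥0) := by exact_mod_cast NeZero.pos _
    have h1 := le_two_mul_numMessages n (N : ℝ≥0)
    rw [NNReal.coe_natCast, mul_comm, Real.rpow_mul two_pos.le, Real.rpow_natCast,
      Real.rpow_natCast] at h1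
    rw [div_le_iff₀ h0, div_pow]
    calc (N : ℝ) ^ n = (N : ℝ) ^ n / (2 ^ N) ^ n * (2 ^ N) ^ n := by field_simp
      _ ≤ (N : ℝ) ^ n / (2 ^ N) ^ n * (2 * numMessages n (N : ℝ≥0)) := by gcongr
      _ = _ := by ring
  refine squeeze_zero (fun n => by positivity) hle ?_
  simpa using (tendsto_pow_atTop_nhds_zero_of_lt_one (by positivity) hlt).const_mul 2

variable {X₁ X₂ X₃ : Type*} [Fintype X₁] [Fintype X₂] [Fintype X₃]

theorem achievable_of_mutualInfo_lt (q : PMF (X₁ × X₂ × X₃)) {R₁₂ R₂₃ : ℝ≥0}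
    (h₁₂ : mutualInfo (q.map fun x => ((x.2.1, x.2.2), x.1)) < R₁₂)
    (h₂₃ : mutualInfo (q.map fun x => (x.2.2, x.1)) < R₂₃) :
    Achievable q (((Fintype.card X₂ * Fintype.card X₃ : ℕ) : ℝ≥0), R₁₂, R₂₃) := by
  set p := q.map fun x => ((x.2.1, x.2.2), x.1) with hp
  set p' := q.map fun x => (x.2.2, x.1)
  -- Needed when `R₁₂ < R₂₃`: the number of clouds is then limited by `M₁₂`, whose rate must still
  -- exceed `I(X₃;X₁)`.
  have hdpi : mutualInfo p' ≤ mutualInfo p := by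
    have h := mutualInfo_map_le p Prod.snd
    rw [hp, PMF.map_comp] at h
    exact h
  obtain ⟨δ, hδ, h1, h2⟩ : ∃ δ : ℝ, 0 < δ ∧ mutualInfo p + δ < R₁₂ ∧ mutualInfo p' + δ < R₂₃ := by
    refine ⟨min (R₁₂ - mutualInfo p) (R₂₃ - mutualInfo p') / 2, ?_, ?_, ?_⟩
    · have := lt_min (sub_pos.mpr h₁₂) (sub_pos.mpr h₂₃)
      linarith
    · have := min_le_left (R₁₂ - mutualInfo p) (R₂₃ - mutualInfo p')
      linarith
    · have := min_le_right (R₁₂ - mutualInfo p) (R₂₃ - mutualInfo p')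
      linarith
  set N : ℕ := Fintype.card X₂ * Fintype.card X₃
  have hcode : ∀ n : ℕ, ∃ c : LineCode X₁ X₂ X₃ (numMessages n N) (numMessages n R₁₂)
      (numMessages n R₂₃) n, l1Dist (c.induced q) (iid q n) ≤
      2 * ((2 * ((2 : ℝ) ^ ((n : ℝ) * (mutualInfo p + δ)) / numMessages n R₁₂) +
        ((2 : ℝ) ^ ((n : ℝ) * (mutualInfo p' + δ)) / numMessages n R₁₂ +
        (2 : ℝ) ^ ((n : ℝ) * (mutualInfo p' + δ)) / numMessages n R₂₃)) +
        (((iid p n).toOuterMeasure (atypical p δ n)).toReal +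
        ((iid p' n).toOuterMeasure (atypical p' δ n)).toReal)) +
      √((N : ℝ) ^ n / numMessages n (N : ℝ≥0)) := by
    intro n
    set k := numMessages n R₁₂
    set k' := numMessages n R₂₃
    have hk : 0 < k := NeZero.pos _
    have hk' : 0 < k' := NeZero.pos _
    -- A cloud index must fit into both messages, so the number of clouds is the smaller count; the
    -- rest of `M₁₂` numbers satellites. Rounding in `k / J` costs at most a factor two, because `L
    -- ≥ 1`.
    set J := min k k' with hJ
    set L := k / J with hL
    have hJ0 : 0 < J := lt_min hk hk'
    have hL0 : 0 < L := Nat.div_pos (min_le_left _ _) hJ0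
    have : NeZero J := ⟨hJ0.ne'⟩
    have : NeZero L := ⟨hL0.ne'⟩
    obtain ⟨c, hc⟩ := exists_lineCode_l1Dist_le (k₀ := numMessages n N) q
      (Nat.mul_div_le k J : J * L ≤ k) (min_le_right k k' : J ≤ k') δ
    refine ⟨c, hc.trans ?_⟩
    have hkR : (0 : ℝ) < k := by exact_mod_cast hk
    have hkR' : (0 : ℝ) < k' := by exact_mod_cast hk'
    have hJR : (0 : ℝ) < J := by exact_mod_cast hJ0
    have hLR : (0 : ℝ) < L := by exact_mod_cast hL0
    have hJL : (k : ℝ) ≤ 2 * (J * L) := by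
      have h3 : k < J * (L + 1) := by
        rw [hL, mul_comm]
        exact Nat.lt_mul_of_div_lt (Nat.lt_succ_self _) hJ0
      have h4 : k ≤ 2 * (J * L) := by nlinarith
      exact_mod_cast h4
    have e1 : (2 : ℝ) ^ ((n : ℝ) * (mutualInfo p + δ)) / (J * L) ≤
        2 * ((2 : ℝ) ^ ((n : ℝ) * (mutualInfo p + δ)) / k) := by
      rw [mul_div_assoc', div_le_div_iff₀ (by positivity) hkR]
      have := mul_le_mul_of_nonneg_left hJL
        (show (0 : ℝ) ≤ (2 : ℝ) ^ ((n : ℝ) * (mutualInfo p + δ)) by positivity)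
      linarith
    -- Which count is smaller may vary with `n`, so the quotient is bounded by the sum of both
    -- possibilities.
    have e2 : (2 : ℝ) ^ ((n : ℝ) * (mutualInfo p' + δ)) / J ≤
        (2 : ℝ) ^ ((n : ℝ) * (mutualInfo p' + δ)) / k +
        (2 : ℝ) ^ ((n : ℝ) * (mutualInfo p' + δ)) / k' := by
      rcases min_choice k k' with h | h
      · rw [hJ, h]
        exact le_add_of_nonneg_right (by positivity)
      · rw [hJ, h]
        exact le_add_of_nonneg_left (by positivity)
    gcongr
  choose c hc using hcode
  refine ⟨c, squeeze_zero (fun n => Finset.sum_nonneg fun _ _ => abs_nonneg _) hc ?_⟩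
  have hlim := (((((tendsto_div_numMessages h1).const_mul 2).add
    ((tendsto_div_numMessages (lt_of_le_of_lt (by linarith) h1 : mutualInfo p' + δ < R₁₂)).add
      (tendsto_div_numMessages h2))).add
    ((tendsto_iid_atypical p hδ).add (tendsto_iid_atypical p' hδ))).const_mul 2).add
    (tendsto_pow_div_numMessages N).sqrt
  simpa using hlim

theorem Achievable.randomized {q : PMF (X₁ × X₂ × X₃)} {R : ℝ≥0 × ℝ≥0 × ℝ≥0}
    (h : Achievable q R) : AchievableRandomized q R := by
  obtain ⟨c, hc⟩ := h
  refine ⟨fun n => ⟨fun m x => PMF.pure ((c n).f₁₂ m x),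
    fun m j => PMF.pure ((c n).g₂ m j, (c n).f₂₃ m j), fun m j => PMF.pure ((c n).g₃ m j)⟩, ?_⟩
  convert hc using 3 with n
  simp only [RandomizedLineCode.induced, LineCode.induced, PMF.pure_bind, PMF.pure_map]
  rfl

/-- Boundary rates are limits of strictly larger ones. The rate of common randomness in
`achievable_of_mutualInfo_lt` does not depend on `R₁₂` and `R₂₃`, so the approximating triplets
share one `R₀`, and the limit lies in the closure before projection. -/
lemma mem_projection_capacityRegion (q : PMF (X₁ × X₂ × X₃)) {R : ℝ≥0 × ℝ≥0}
    (h₁₂ : mutualInfo (q.map fun x => ((x.2.1, x.2.2), x.1)) ≤ (R.1 : ℝ))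
    (h₂₃ : mutualInfo (q.map fun x => (x.2.2, x.1)) ≤ (R.2 : ℝ)) :
    R ∈ projection (capacityRegion q) := by
  refine ⟨((Fintype.card X₂ * Fintype.card X₃ : ℕ) : ℝ≥0), ?_⟩
  have hε : Tendsto (fun m : ℕ => 1 / ((m : ℝ≥0) + 1)) atTop (𝓝 0) :=
    tendsto_one_div_add_atTop_nhds_zero_nat
  have hlim := (tendsto_const_nhds
    (x := ((Fintype.card X₂ * Fintype.card X₃ : ℕ) : ℝ≥0))).prodMk_nhds
      ((hε.const_add R.1).prodMk_nhds (hε.const_add R.2))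
  rw [add_zero, add_zero] at hlim
  refine mem_closure_of_tendsto hlim (Eventually.of_forall fun m => ?_)
  have hpos : (0 : ℝ) < ((1 / ((m : ℝ≥0) + 1) : ℝ≥0) : ℝ) := by positivity
  refine achievable_of_mutualInfo_lt q (h₁₂.trans_lt ?_) (h₂₃.trans_lt ?_) <;>
  · rw [NNReal.coe_add]
    exact lt_add_of_pos_right _ hpos

lemma capacityRegion_subset_randomized (q : PMF (X₁ × X₂ × X₃)) :
    capacityRegion q ⊆ capacityRegionRandomized q :=
  closure_mono fun _ h => Achievable.randomized h

/-- The converse bounds are weak inequalities between continuous functions, so they survive the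
closure. -/
lemma capacityRegionRandomized_subset (q : PMF (X₁ × X₂ × X₃)) :
    capacityRegionRandomized q ⊆
      {R | mutualInfo (q.map fun x => ((x.2.1, x.2.2), x.1)) ≤ (R.2.1 : ℝ) ∧
        mutualInfo (q.map fun x => (x.2.2, x.1)) ≤ (R.2.2 : ℝ)} := by
  refine closure_minimal (fun R h => AchievableRandomized.mutualInfo_le h) ?_
  have h₁₂ : Continuous fun R : ℝ≥0 × ℝ≥0 × ℝ≥0 => (R.2.1 : ℝ) := by fun_prop
  have h₂₃ : Continuous fun R : ℝ≥0 × ℝ≥0 × ℝ≥0 => (R.2.2 : ℝ) := by fun_prop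
  exact (isClosed_le continuous_const h₁₂).inter (isClosed_le continuous_const h₂₃)

end Achievability

end LineCoordination

theorem corollary1 {X₁ X₂ X₃ : Type*} [Fintype X₁] [Fintype X₂] [Fintype X₃]
    (q : PMF (X₁ × X₂ × X₃)) :
    LineCoordination.projection (LineCoordination.capacityRegion q) =
      {R : ℝ≥0 × ℝ≥0 |
        LineCoordination.mutualInfo (q.map fun x => ((x.2.1, x.2.2), x.1)) ≤ (R.1 : ℝ) ∧
        LineCoordination.mutualInfo (q.map fun x => (x.2.2, x.1)) ≤ (R.2 : ℝ)} ∧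
    LineCoordination.projection (LineCoordination.capacityRegionRandomized q) =
      {R : ℝ≥0 × ℝ≥0 |
        LineCoordination.mutualInfo (q.map fun x => ((x.2.1, x.2.2), x.1)) ≤ (R.1 : ℝ) ∧
        LineCoordination.mutualInfo (q.map fun x => (x.2.2, x.1)) ≤ (R.2 : ℝ)} := by
  open LineCoordination in
  refine ⟨Set.Subset.antisymm ?_ ?_, Set.Subset.antisymm ?_ ?_⟩
  · rintro R ⟨R₀, h⟩
    exact capacityRegionRandomized_subset q (capacityRegion_subset_randomized q h)
  · rintro R ⟨h₁₂, h₂₃⟩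
    exact mem_projection_capacityRegion q h₁₂ h₂₃
  · rintro R ⟨R₀, h⟩
    exact capacityRegionRandomized_subset q h
  · rintro R ⟨h₁₂, h₂₃⟩
    obtain ⟨R₀, h⟩ := mem_projection_capacityRegion q h₁₂ h₂₃
    exact ⟨R₀, capacityRegion_subset_randomized q h⟩
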